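/- Let $C\subset\mathbb{R}^2$ be a convex disc, that is, a compact convex set with non-empty interior. Two sets touch if they intersect but their interiors are disjoint. A Hadwiger family of $C$ is a collection of translates $v_i+C$ of $C$, all touching $C$ and with pairwise disjoint interiors; a strict Hadwiger family is a collection of translates of $C$, all touching $C$ and pairwise disjoint. Let $H(C)$ and $H'(C)$ denote the maximum number of translates in a Hadwiger family, respectively strict Hadwiger family, of $C$. Let $H_+(C)$, respectively $H_+^o(C)$, denote the maximum number of translates in a Hadwiger family $\{v_i+C\}$ of $C$ for which all the translation vectors $v_i$ lie in a closed, respectively open, half plane with the origin on its boundary. For the central symmetral $B=\frac12(C-C)=\{\frac12(x-y): x,y\in C\}$, let $\lambda(B)$ be the largest length of a (possibly degenerate) segment contained in the boundary $\partial B$, measured in the norm with unit ball $B$. Then: 1. if $C$ is not a parallelogram, then $H(C)=6$, $H'(C)=5$ and $H_+(C)=4$; 2. if $C$ is a parallelogram, then $H(C)=8$, $H'(C)=4$ and $H_+(C)=5$; 3. $H_+^o(C)=4$ if $\lambda(\frac12(C-C))>1$, and $H_+^o(C)=3$ otherwise. -/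

import Mathlib

open scoped Pointwise

noncomputable section

variable {E : Type*} [NormedAddCommGroup E] [NormedSpace ℝ E]

/-- Two sets touch if they intersect but their interiors do not. -/
def Touches (A B : Set E) : Prop :=
  (A ∩ B).Nonempty ∧ Disjoint (interior A) (interior B)

/-- The translates `v + C`, `v ∈ V`, form a Hadwiger family of `C`: they all touch `C` and have
pairwise disjoint interiors. -/
def IsHadwigerFamily (C V : Set E) : Prop :=
  (∀ v ∈ V, Touches (v +ᵥ C) C) ∧
    V.Pairwise fun v w => Disjoint (interior (v +ᵥ C)) (interior (w +ᵥ C))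

/-- The translates `v + C`, `v ∈ V`, form a strict Hadwiger family of `C`: they all touch `C` and
are pairwise disjoint. -/
def IsStrictHadwigerFamily (C V : Set E) : Prop :=
  (∀ v ∈ V, Touches (v +ᵥ C) C) ∧ V.Pairwise fun v w => Disjoint (v +ᵥ C) (w +ᵥ C)

/-- `V` lies in a closed half space with the origin on its boundary. -/
def InClosedHalfSpace (V : Set E) : Prop :=
  ∃ f : E →L[ℝ] ℝ, f ≠ 0 ∧ ∀ v ∈ V, 0 ≤ f v

/-- `V` lies in an open half space with the origin on its boundary. -/
def InOpenHalfSpace (V : Set E) : Prop :=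
  ∃ f : E →L[ℝ] ℝ, f ≠ 0 ∧ ∀ v ∈ V, 0 < f v

/-- The Hadwiger number `H(C)`. The supremum is taken in `ℕ∞`, over finite and infinite families;
when its value is finite it is attained. -/
def hadwigerNumber (C : Set E) : ℕ∞ :=
  sSup (Set.encard '' {V : Set E | IsHadwigerFamily C V})

/-- The strict Hadwiger number `H'(C)`. -/
def strictHadwigerNumber (C : Set E) : ℕ∞ :=
  sSup (Set.encard '' {V : Set E | IsStrictHadwigerFamily C V})

/-- The one-sided Hadwiger number `H₊(C)`. -/
def oneSidedHadwigerNumber (C : Set E) : ℕ∞ :=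
  sSup (Set.encard '' {V : Set E | IsHadwigerFamily C V ∧ InClosedHalfSpace V})

/-- The open one-sided Hadwiger number `H₊ᵒ(C)`. -/
def openOneSidedHadwigerNumber (C : Set E) : ℕ∞ :=
  sSup (Set.encard '' {V : Set E | IsHadwigerFamily C V ∧ InOpenHalfSpace V})

/-- The central symmetral `½(C - C)`. -/
def centralSymmetral (C : Set E) : Set E := (2⁻¹ : ℝ) • (C - C)

/-- `λ(B)`: the largest length, in the norm with unit ball `B` (the gauge of `B`), of a segment
contained in the boundary of `B`. For an origin-symmetric convex body `B` these lengths are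
bounded by `2`, and degenerate segments are allowed, with length `0`. -/
def maxBoundarySegment (B : Set E) : ℝ :=
  sSup {l : ℝ | ∃ x y : E, segment ℝ x y ⊆ frontier B ∧ l = gauge B (y - x)}

/-- `C` is a (nondegenerate) parallelogram. -/
def IsParallelogram (C : Set E) : Prop :=
  ∃ (p : E) (w : Fin 2 → E), LinearIndependent ℝ w ∧ C = p +ᵥ parallelepiped w

end

/-! Give the plane the norm with unit ball `C - C`. Then `v + C` touches `C` exactly when `‖v‖ = 1`,
two translates have disjoint interiors exactly when their vectors are at distance at least 1, and
they are disjoint exactly when this distance exceeds 1. All four numbers thus count separated unit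
vectors. `C` is a parallelogram exactly when the unit ball is one (`HasSquareBall`), and `λ > 1`
exactly when the sphere contains a segment longer than 1 (`HasLongSide`).

The upper bounds rest on the rigidity lemma `eq_smul_sub_of_separated`. If `a`, `b`, `c` are
consecutive and separated and `a` is on the same side as `b` and `c` of the line through 0 parallel
to `b - c`, triangle inequalities force `‖b - c‖ = 1` and `a + c = r b` with `1 < r ≤ 2`; the
segment from `-c` to `a`, of length `r`, then lies on the sphere. Among four vectors of an open half
plane, the first or the last is always on that side of the middle pair, by the Plücker relation, so
four such vectors produce a long side. Five vectors in a closed half plane contain two such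
quadruples; all estimates become equalities, the ball is a parallelogram and the end vectors are
antipodal. Counting on both sides of a line through a member excludes nine vectors. Seven are
impossible off the parallelogram case by parity: of two cyclic neighbours exactly one would be a
multiple of the sum of its own neighbours. For strict families distance 1 is forbidden, so the rigid
configuration never occurs, and six vectors would be symmetric with `a = b - c`.

For the lower bounds, continuity on the sphere gives an affine regular hexagon `±u, ±v, ±(v - u)`.
Five pairwise disjoint translates come from perturbing five of its vertices when there is no long
side, and otherwise from a maximal side. The parallelogram is handled in max-norm coordinates. -/

section Separated

variable {F : Type*} [NormedAddCommGroup F]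

/-- Unit vectors at pairwise distance at least `1`. -/
def IsSeparated (V : Set F) : Prop :=
  (∀ v ∈ V, ‖v‖ = 1) ∧ V.Pairwise fun v w => 1 ≤ ‖v - w‖

/-- Unit vectors at pairwise distance greater than `1`. -/
def IsStrictlySeparated (V : Set F) : Prop :=
  (∀ v ∈ V, ‖v‖ = 1) ∧ V.Pairwise fun v w => 1 < ‖v - w‖

theorem IsSeparated.mono {V W : Set F} (h : IsSeparated V) (hW : W ⊆ V) : IsSeparated W :=
  ⟨fun v hv => h.1 v (hW hv), h.2.mono hW⟩

theorem IsStrictlySeparated.mono {V W : Set F} (h : IsStrictlySeparated V) (hW : W ⊆ V) :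
    IsStrictlySeparated W :=
  ⟨fun v hv => h.1 v (hW hv), h.2.mono hW⟩

theorem IsStrictlySeparated.isSeparated {V : Set F} (h : IsStrictlySeparated V) :
    IsSeparated V :=
  ⟨h.1, fun _ hv _ hw hne => (h.2 hv hw hne).le⟩

end Separated

/-! ### Convexity of the norm along lines, and rigidity of separated triples. -/

section NormedSpace

variable {F : Type*} [NormedAddCommGroup F] [NormedSpace ℝ F]

/-- Some unit vectors `x`, `y` have `x + y` and `x - y` in the unit ball, which then is the
parallelogram with vertices `±x ± y`. -/
def HasSquareBall (F : Type*) [NormedAddCommGroup F] [NormedSpace ℝ F] : Prop :=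
  ∃ x y : F, ‖x‖ = 1 ∧ ‖y‖ = 1 ∧ ‖x + y‖ ≤ 1 ∧ ‖x - y‖ ≤ 1

/-- The unit sphere contains a segment of length greater than `1`. -/
def HasLongSide (F : Type*) [NormedAddCommGroup F] [NormedSpace ℝ F] : Prop :=
  ∃ (x w : F) (l : ℝ), 1 < l ∧ ‖w‖ = 1 ∧ ∀ t ∈ Set.Icc (0 : ℝ) l, ‖x + t • w‖ = 1

theorem norm_combo_le (x y : F) {α β : ℝ} (hα : 0 ≤ α) (hβ : 0 ≤ β) :
    ‖α • x + β • y‖ ≤ α * ‖x‖ + β * ‖y‖ := by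
  calc ‖α • x + β • y‖ ≤ ‖α • x‖ + ‖β • y‖ := norm_add_le _ _
    _ = α * ‖x‖ + β * ‖y‖ := by
      rw [norm_smul, norm_smul, Real.norm_of_nonneg hα, Real.norm_of_nonneg hβ]

/-- The three-point form of convexity of the norm on a line. -/
theorem norm_line_three (x w : F) {s m t : ℝ} (hsm : s ≤ m) (hmt : m ≤ t) :
    (t - s) * ‖x + m • w‖ ≤ (t - m) * ‖x + s • w‖ + (m - s) * ‖x + t • w‖ := by
  have h := norm_combo_le (x + s • w) (x + t • w) (sub_nonneg.2 hmt) (sub_nonneg.2 hsm)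
  have e : (t - m) • (x + s • w) + (m - s) • (x + t • w) = (t - s) • (x + m • w) := by module
  rwa [e, norm_smul, Real.norm_of_nonneg (by linarith)] at h

/-- If the norm on a line is at most `1` at two parameters and at least `1` at one strictly in
between, then it is `1` on the whole segment. -/
theorem norm_line_eq_one {x w : F} {s m t : ℝ} (hsm : s < m) (hmt : m < t)
    (hs : ‖x + s • w‖ ≤ 1) (ht : ‖x + t • w‖ ≤ 1) (hm : 1 ≤ ‖x + m • w‖) {r : ℝ}
    (hr : r ∈ Set.Icc s t) : ‖x + r • w‖ = 1 := by
  have hle : ‖x + r • w‖ ≤ 1 := by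
    have := norm_line_three x w hr.1 hr.2
    have h1 : (t - r) * ‖x + s • w‖ ≤ (t - r) * 1 :=
      mul_le_mul_of_nonneg_left hs (sub_nonneg.2 hr.2)
    have h2 : (r - s) * ‖x + t • w‖ ≤ (r - s) * 1 :=
      mul_le_mul_of_nonneg_left ht (sub_nonneg.2 hr.1)
    have h3 : (t - s) * ‖x + r • w‖ ≤ (t - s) * 1 := by linarith
    exact le_of_mul_le_mul_left h3 (by linarith)
  refine le_antisymm hle ?_
  rcases le_total r m with h | h
  · have := norm_line_three x w h hmt.le
    have h1 : (t - r) * 1 ≤ (t - r) * ‖x + m • w‖ :=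
      mul_le_mul_of_nonneg_left hm (by linarith)
    have h2 : (m - r) * ‖x + t • w‖ ≤ (m - r) * 1 :=
      mul_le_mul_of_nonneg_left ht (by linarith)
    have h3 : (t - m) * 1 ≤ (t - m) * ‖x + r • w‖ := by linarith
    exact le_of_mul_le_mul_left h3 (by linarith)
  · have := norm_line_three x w hsm.le h
    have h1 : (r - s) * 1 ≤ (r - s) * ‖x + m • w‖ :=
      mul_le_mul_of_nonneg_left hm (by linarith)
    have h2 : (r - m) * ‖x + s • w‖ ≤ (r - m) * 1 :=
      mul_le_mul_of_nonneg_left hs (by linarith)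
    have h3 : (m - s) * 1 ≤ (m - s) * ‖x + r • w‖ := by linarith
    exact le_of_mul_le_mul_left h3 (by linarith)

/-- The line through a segment of the unit sphere misses the open unit ball. -/
theorem one_le_norm_line {x w : F} {s m t : ℝ} (hsm : s < m) (hmt : m < t)
    (hs : ‖x + s • w‖ ≤ 1) (ht : ‖x + t • w‖ ≤ 1) (hm : 1 ≤ ‖x + m • w‖) (r : ℝ) :
    1 ≤ ‖x + r • w‖ := by
  by_contra! hlt
  rcases lt_trichotomy r m with h | h | h
  · have := norm_line_three x w h.le hmt.le
    have h1 : (t - r) * 1 ≤ (t - r) * ‖x + m • w‖ :=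
      mul_le_mul_of_nonneg_left hm (by linarith)
    have h2 : (m - r) * ‖x + t • w‖ ≤ (m - r) * 1 :=
      mul_le_mul_of_nonneg_left ht (by linarith)
    have h3 : (t - m) * ‖x + r • w‖ < (t - m) * 1 :=
      mul_lt_mul_of_pos_left hlt (by linarith)
    linarith
  · subst h; linarith
  · have := norm_line_three x w hsm.le h.le
    have h1 : (r - s) * 1 ≤ (r - s) * ‖x + m • w‖ :=
      mul_le_mul_of_nonneg_left hm (by linarith)
    have h2 : (r - m) * ‖x + s • w‖ ≤ (r - m) * 1 :=
      mul_le_mul_of_nonneg_left hs (by linarith)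
    have h3 : (m - s) * ‖x + r • w‖ < (m - s) * 1 :=
      mul_lt_mul_of_pos_left hlt (by linarith)
    linarith

/-- The key rigidity lemma: if `a`, `b`, `c` are unit vectors in this angular order, `a` and `b`,
and `b` and `c`, are at distance at least `1`, and `a` lies strictly on the same side as `b` and
`c` of the line through the origin parallel to `b - c`, then `a + c` is a multiple of `b`. -/
theorem eq_smul_sub_of_separated {a b c : F} (ha : ‖a‖ = 1) (hb : ‖b‖ = 1) (hc : ‖c‖ = 1)
    (hab : 1 ≤ ‖a - b‖) (hbc : 1 ≤ ‖b - c‖) {r s : ℝ} (hs : 0 < s) (hrs : s < r)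
    (h : a = r • b - s • c) :
    ‖b - c‖ = 1 ∧ s = 1 ∧ r ≤ 2 := by
  have h1 : r ≤ 1 + s := by
    have := norm_combo_le a c zero_le_one hs.le
    have e : (1 : ℝ) • a + s • c = r • b := by rw [h]; module
    rw [e, norm_smul, Real.norm_of_nonneg (by linarith), ha, hb, hc] at this
    linarith
  have h2 : 1 ≤ r := by
    by_contra! hr
    have := norm_combo_le b c (sub_nonneg.2 hr.le) hs.le
    have e : (1 - r) • b + s • c = -(a - b) := by rw [h]; module
    rw [e, norm_neg, hb, hc] at this
    linarith
  have h3 : r - s ≤ (r - 1) * ‖b - c‖ := by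
    have := norm_combo_le (b - c) (-c) (sub_nonneg.2 h2) (show 0 ≤ 1 - (r - s) by linarith)
    have e : (r - 1) • (b - c) + (1 - (r - s)) • -c = a - b := by rw [h]; module
    rw [e, norm_neg, hc] at this
    linarith
  have h4 : r * ‖b - c‖ ≤ 1 + (r - s) := by
    have := norm_combo_le a (-c) zero_le_one (show 0 ≤ r - s by linarith)
    have e : (1 : ℝ) • a + (r - s) • -c = r • (b - c) := by rw [h]; module
    rw [e, norm_smul, Real.norm_of_nonneg (by linarith), norm_neg, ha, hc] at this
    linarith
  -- Adding `h3` and `h4` cancels `r - s` and leaves `‖b - c‖ ≤ 1`.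
  have h5 : ‖b - c‖ = 1 := le_antisymm (by linarith) hbc
  rw [h5] at h3 h4
  exact ⟨h5, by linarith, by linarith⟩

/-- The line runs through `-c` at 0, `b - c` at 1 and `a` at `r`. The norm is 1 at both ends and at
least 1 at an inner point, so convexity makes it constant. -/
theorem norm_eq_one_of_add_eq_smul {a b c : F} (ha : ‖a‖ = 1) (hc : ‖c‖ = 1)
    (hbc : 1 ≤ ‖b - c‖) {r : ℝ} (hr : 1 < r) (h : a + c = r • b) {t : ℝ}
    (ht : t ∈ Set.Icc 0 r) : ‖-c + t • b‖ = 1 := by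
  refine norm_line_eq_one (m := 1) zero_lt_one hr (by simp [hc]) ?_ ?_ ht
  · rw [← h]; simp [ha]
  · rw [one_smul, neg_add_eq_sub]; exact hbc

theorem hasLongSide_of_add_eq_smul {a b c : F} (ha : ‖a‖ = 1) (hb : ‖b‖ = 1) (hc : ‖c‖ = 1)
    (hbc : 1 ≤ ‖b - c‖) {r : ℝ} (hr : 1 < r) (h : a + c = r • b) : HasLongSide F :=
  ⟨-c, b, r, hr, hb, fun _ ht => norm_eq_one_of_add_eq_smul ha hc hbc hr h ht⟩

/-- Two consecutive unit vectors cannot both lie between their neighbours on a line off the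
origin. -/
theorem not_consecutive_add_eq_smul {a p q d : F} (ha : ‖a‖ = 1) (hd : ‖d‖ = 1)
    (hpq : 1 ≤ ‖p - q‖) {r s : ℝ} (hr : 1 < r) (hs : 1 < s)
    (h : a + q = r • p) (h' : p + d = s • q) : False := by
  -- The coefficients make the combination a multiple of `p - q`; the estimate becomes `r s - 1 ≤ (s
  -- - 1) + (r - 1)`, that is `(r - 1)(s - 1) ≤ 0`.
  have := norm_combo_le a (-d) (sub_nonneg.2 hs.le) (sub_nonneg.2 hr.le)
  have ea : a = r • p - q := eq_sub_of_add_eq h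
  have ed : d = s • q - p := eq_sub_of_add_eq' h'
  have e : (s - 1) • a + (r - 1) • -d = (r * s - 1) • (p - q) := by
    rw [ea, ed]; module
  have hrs : 0 < r * s - 1 := by nlinarith
  rw [e, norm_smul, Real.norm_of_nonneg hrs.le, norm_neg, ha, hd] at this
  nlinarith [mul_pos (sub_pos.2 hr) (sub_pos.2 hs)]

/-- The norm whose unit ball is the parallelogram with vertices `±x ± y`. -/
theorem norm_eq_max_of_square {x y : F} (hx : ‖x‖ = 1) (hy : ‖y‖ = 1) (hxy : ‖x + y‖ ≤ 1)
    (hxy' : ‖x - y‖ ≤ 1) (α β : ℝ) : ‖α • x + β • y‖ = max |α| |β| := by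
  have key : ∀ (x y : F), ‖x‖ = 1 → ‖x + y‖ ≤ 1 → ‖x - y‖ ≤ 1 →
      ∀ α β : ℝ, |β| ≤ |α| → ‖α • x + β • y‖ = |α| := by
    intro x y hx hxy hxy' α β hβ
    have up : ∀ β : ℝ, |β| ≤ |α| → ‖α • x + β • y‖ ≤ |α| := by
      intro β hβ
      have aux : ∀ γ : ℝ, |γ| ≤ |α| → ‖|α| • x + γ • y‖ ≤ |α| := by
        intro γ hγ
        obtain ⟨h1, h2⟩ := abs_le.1 hγ
        have := norm_combo_le (x + y) (x - y) (show 0 ≤ (|α| + γ) / 2 by linarith)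
          (show 0 ≤ (|α| - γ) / 2 by linarith)
        have e : ((|α| + γ) / 2) • (x + y) + ((|α| - γ) / 2) • (x - y) = |α| • x + γ • y := by
          module
        rw [e] at this
        nlinarith
      rcases abs_choice α with h | h
      · have := aux β hβ
        rwa [h] at this ⊢
      · have := aux (-β) (by rwa [abs_neg])
        rw [h] at this ⊢
        rwa [← norm_neg, show -(α • x + β • y) = -α • x + -β • y by module]
    refine le_antisymm (up β hβ) ?_
    -- Lower bound by reflection: `α x` is the midpoint of `α x + β y` and `α x - β y`, and the
    -- latter has norm at most `|α|`.
    have h1 := norm_add_le (α • x + β • y) (α • x + (-β) • y)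
    have h2 := up (-β) (by rwa [abs_neg])
    have e : α • x + β • y + (α • x + (-β) • y) = (2 * α) • x := by module
    rw [e, norm_smul, hx, Real.norm_eq_abs, abs_mul, abs_two] at h1
    linarith
  rcases le_total |β| |α| with h | h
  · rw [key x y hx hxy hxy' α β h, max_eq_left h]
  · rw [add_comm, key y x hy (by rwa [add_comm]) (by rwa [norm_sub_rev]) β α h, max_eq_right h]

end NormedSpace

/-! ### Area forms and the angular order of unit vectors in a half plane. -/

section AreaForm

variable {F : Type*} [NormedAddCommGroup F] [NormedSpace ℝ F]

/-- A nondegenerate alternating form on a real plane; Cramer's rule says that the dimension is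
at most two. -/
structure IsAreaForm (ω : F →ₗ[ℝ] F →ₗ[ℝ] ℝ) : Prop where
  self : ∀ x, ω x x = 0
  cramer : ∀ a b c, ω b c • a = ω a c • b - ω a b • c
  nondegenerate : ∀ x, x ≠ 0 → ∃ y, ω x y ≠ 0

namespace IsAreaForm

variable {ω : F →ₗ[ℝ] F →ₗ[ℝ] ℝ}

theorem swap (h : IsAreaForm ω) (x y : F) : ω y x = -ω x y := by
  have := h.self (x + y)
  simp only [map_add, LinearMap.add_apply, h.self] at this
  linarith

/-- Cramer's rule paired with `d`. -/
theorem plucker (h : IsAreaForm ω) (a b c d : F) :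
    ω a b * ω c d - ω a c * ω b d + ω a d * ω b c = 0 := by
  have := congrArg (fun z => ω z d) (h.cramer a b c)
  simp only [map_sub, map_smul, LinearMap.sub_apply, LinearMap.smul_apply, smul_eq_mul] at this
  linarith

theorem eq_or_eq_neg (h : IsAreaForm ω) {a b : F} (ha : ‖a‖ = 1) (hb : ‖b‖ = 1)
    (hab : ω a b = 0) : b = a ∨ b = -a := by
  obtain ⟨y, hy⟩ := h.nondegenerate a (by rintro rfl; simp at ha)
  have hc := h.cramer b a y
  rw [h.swap a b, hab, neg_zero, zero_smul, sub_zero] at hc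
  have hb' : b = (ω b y / ω a y) • a := by
    rw [div_eq_inv_mul, mul_smul, ← hc, smul_smul, inv_mul_cancel₀ hy, one_smul]
  have ht : |ω b y / ω a y| = 1 := by
    have := congrArg norm hb'
    rw [norm_smul, ha, hb, mul_one, Real.norm_eq_abs] at this
    exact this.symm
  rcases (abs_eq zero_le_one).1 ht with h1 | h1 <;> rw [h1] at hb'
  · left; simpa using hb'
  · right; simpa using hb'

theorem neg (h : IsAreaForm ω) : IsAreaForm (-ω) where
  self x := by simp [h.self]
  cramer a b c := by
    have := congrArg Neg.neg (h.cramer a b c)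
    simp only [LinearMap.neg_apply, neg_smul]
    rw [this]; abel
  nondegenerate x hx := by
    obtain ⟨y, hy⟩ := h.nondegenerate x hx
    exact ⟨y, by simpa using hy⟩

end IsAreaForm

theorem Finset.exists_enum_of_injOn {α : Type*} (s : Finset α) (k : α → ℝ)
    (hk : Set.InjOn k s) {n : ℕ} (hn : s.card = n) :
    ∃ g : Fin n → α, (∀ i, g i ∈ s) ∧ ∀ i j, i < j → k (g i) < k (g j) := by
  classical
  have hc : (s.image k).card = n := by rw [Finset.card_image_of_injOn hk, hn]
  have : ∀ i : Fin n, ∃ x ∈ s, k x = (s.image k).orderEmbOfFin hc i := fun i =>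
    Finset.mem_image.1 (Finset.orderEmbOfFin_mem _ hc i)
  choose g hg hgk using this
  refine ⟨g, hg, fun i j hij => ?_⟩
  rw [hgk, hgk]
  exact ((s.image k).orderEmbOfFin hc).strictMono hij

namespace IsAreaForm

variable {ω : F →ₗ[ℝ] F →ₗ[ℝ] ℝ}

/-- The position of a vector of the closed half plane `0 ≤ f` in the angular order; here
`g` is the coordinate complementary to `f`. -/
theorem nonneg_of_key_lt {gp fp gq fq : ℝ} (hp : 0 ≤ fp) (hq : 0 ≤ fq) (hp' : 0 < |gp| + fp)
    (hq' : 0 < |gq| + fq) (hk : -gp / (|gp| + fp) < -gq / (|gq| + fq)) :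
    0 ≤ gp * fq - fp * gq := by
  rw [div_lt_div_iff₀ hp' hq'] at hk
  rcases abs_cases gp with ⟨h1, h1'⟩ | ⟨h1, h1'⟩ <;>
  rcases abs_cases gq with ⟨h2, h2'⟩ | ⟨h2, h2'⟩ <;> rw [h1, h2] at hk <;> nlinarith

theorem key_inj {gp fp gq fq : ℝ} (hp' : 0 < |gp| + fp)
    (hq' : 0 < |gq| + fq) (hk : -gp / (|gp| + fp) = -gq / (|gq| + fq)) :
    gp * fq - fp * gq = 0 ∧ 0 ≤ gp * gq := by
  rw [div_eq_div_iff hp'.ne' hq'.ne'] at hk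
  have h2 : 0 ≤ gp * gq := by
    by_contra! hneg
    have e : -(gp * gq) * (|gq| + fq) = -(gq * gq) * (|gp| + fp) := by
      linear_combination gq * hk
    nlinarith [mul_self_nonneg gq, mul_pos (neg_pos.2 hneg) hq',
      mul_nonneg (mul_self_nonneg gq) hp'.le]
  refine ⟨?_, h2⟩
  have h3 : gp * |gq| = gq * |gp| := by
    rcases abs_cases gp with ⟨h1, h1'⟩ | ⟨h1, h1'⟩ <;>
    rcases abs_cases gq with ⟨h2, h2'⟩ | ⟨h2, h2'⟩ <;> rw [h1, h2] <;> nlinarith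
  linarith

/-- Finitely many unit vectors in a closed half plane can be put into angular order. -/
theorem exists_angular_enum (h : IsAreaForm ω) {f : F →ₗ[ℝ] ℝ} (hf : f ≠ 0) (s : Finset F)
    (hs : ∀ v ∈ s, ‖v‖ = 1) (hsf : ∀ v ∈ s, 0 ≤ f v) {n : ℕ} (hn : s.card = n) :
    ∃ g : Fin n → F, Function.Injective g ∧ (∀ i, g i ∈ s) ∧
      ∀ i j, i < j → 0 ≤ ω (g i) (g j) := by
  obtain ⟨y, hy⟩ : ∃ y, f y = 1 := by
    obtain ⟨z, hz⟩ : ∃ z, f z ≠ 0 := by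
      by_contra! hz; exact hf (LinearMap.ext hz)
    exact ⟨(f z)⁻¹ • z, by simp [hz]⟩
  have hω : ∀ p q, ω p q = ω p y * f q - f p * ω q y := by
    intro p q
    have := congrArg f (h.cramer y p q)
    simp only [map_sub, map_smul, smul_eq_mul, hy] at this
    rw [h.swap y p, h.swap y q]
    linarith
  have hpos : ∀ p ∈ s, 0 < |ω p y| + f p := by
    intro p hp
    refine lt_of_le_of_ne (add_nonneg (abs_nonneg _) (hsf p hp)) fun h0 => ?_
    have h1 : f p = 0 := by linarith [abs_nonneg (ω p y), hsf p hp]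
    have h2 : ω p y = 0 := by rw [h1, add_zero] at h0; exact abs_eq_zero.1 h0.symm
    obtain ⟨z, hz⟩ := h.nondegenerate p (by rintro rfl; simpa using hs _ hp)
    rw [hω, h1, h2] at hz
    simp at hz
  -- The key is minus the first coordinate after scaling `p` to the diamond `|g| + f = 1`. Unlike a
  -- cotangent it stays finite on the boundary line, where the two opposite directions get the keys
  -- -1 and 1.
  have hinj : Set.InjOn (fun p => -ω p y / (|ω p y| + f p)) s := by
    intro p hp q hq hpq
    obtain ⟨h1, h2⟩ := key_inj (hpos p hp) (hpos q hq) hpq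
    rw [← hω] at h1
    rcases h.eq_or_eq_neg (hs p hp) (hs q hq) h1 with h3 | h3
    · exact h3.symm
    · exfalso
      have h4 := hsf q hq
      have h5 := hpos p hp
      rw [h3, map_neg] at h4
      rw [h3, map_neg, LinearMap.neg_apply] at h2
      have h6 : ω p y = 0 := by nlinarith [mul_self_nonneg (ω p y)]
      rw [h6, abs_zero] at h5
      linarith
  obtain ⟨g, hg, hgk⟩ := s.exists_enum_of_injOn _ hinj hn
  refine ⟨g, fun i j hij => ?_, hg, fun i j hij => ?_⟩
  · by_contra hne
    rcases lt_or_gt_of_ne hne with hlt | hlt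
    · have := hgk _ _ hlt; rw [hij] at this; exact lt_irrefl _ this
    · have := hgk _ _ hlt; rw [hij] at this; exact lt_irrefl _ this
  · rw [hω]
    exact nonneg_of_key_lt (hsf _ (hg i)) (hsf _ (hg j)) (hpos _ (hg i)) (hpos _ (hg j))
      (hgk i j hij)

/-- In an angular enumeration only the first and the last vector can be antipodal. -/
theorem pos_of_angular_enum (h : IsAreaForm ω) {n : ℕ} {g : Fin n → F}
    (hinj : Function.Injective g) (hg : ∀ i, ‖g i‖ = 1) (hord : ∀ i j, i < j → 0 ≤ ω (g i) (g j))
    {i j k : Fin n} (hij : i < j) (hk : k < i ∨ j < k) : 0 < ω (g i) (g j) := by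
  refine lt_of_le_of_ne (hord i j hij) fun h0 => ?_
  have hneg : g j = -g i := (h.eq_or_eq_neg (hg i) (hg j) h0.symm).resolve_left
    fun e => hij.ne' (hinj e)
  have hz : ω (g i) (g k) = 0 := by
    rcases hk with hk | hk
    · have h1 := hord k i hk
      have h2 := hord k j (hk.trans hij)
      rw [hneg, map_neg] at h2
      rw [h.swap]; linarith
    · have h1 := hord i k (hij.trans hk)
      have h2 := hord j k hk
      rw [hneg, map_neg, LinearMap.neg_apply] at h2
      linarith
  rcases h.eq_or_eq_neg (hg i) (hg k) hz with e | e
  · have := hinj e; subst this; rcases hk with hk | hk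
    · exact lt_irrefl _ hk
    · exact lt_asymm hij hk
  · have := hinj (e.trans hneg.symm); subst this; rcases hk with hk | hk
    · exact lt_asymm hij hk
    · exact lt_irrefl _ hk

end IsAreaForm

end AreaForm

/-! ### Chains of consecutive separated vectors. -/

section Chains

variable {F : Type*} [NormedAddCommGroup F] [NormedSpace ℝ F]

namespace IsAreaForm

variable {ω : F →ₗ[ℝ] F →ₗ[ℝ] ℝ}

/-- The hypothesis `hhigh` says `ω (b - c) a > 0`, which is the sign of `ω (b - c)` at `b` and `c`.
Cramer's rule turns it into `a = r b - s c` with `0 < s < r`, and the rigidity lemma applies. -/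
theorem add_eq_smul_of_high_left (h : IsAreaForm ω) {a b c : F} (ha : ‖a‖ = 1) (hb : ‖b‖ = 1)
    (hc : ‖c‖ = 1) (hab : 1 ≤ ‖a - b‖) (hbc : 1 ≤ ‖b - c‖) (hωab : 0 < ω a b)
    (hωbc : 0 < ω b c) (hhigh : ω a b < ω a c) :
    ‖b - c‖ = 1 ∧ ∃ r : ℝ, 1 < r ∧ r ≤ 2 ∧ a + c = r • b := by
  have ea : a = (ω a c / ω b c) • b - (ω a b / ω b c) • c := by
    rw [div_eq_inv_mul, div_eq_inv_mul, mul_smul, mul_smul, ← smul_sub, ← h.cramer, smul_smul,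
      inv_mul_cancel₀ hωbc.ne', one_smul]
  obtain ⟨h1, h2, h3⟩ := eq_smul_sub_of_separated ha hb hc hab hbc (div_pos hωab hωbc)
    (div_lt_div_of_pos_right hhigh hωbc) ea
  refine ⟨h1, _, ?_, h3, ?_⟩
  · rw [← h2]; exact div_lt_div_of_pos_right hhigh hωbc
  · rw [h2, one_smul] at ea
    nth_rewrite 1 [ea]
    abel

theorem add_eq_smul_of_high_right (h : IsAreaForm ω) {b c d : F} (hb : ‖b‖ = 1) (hc : ‖c‖ = 1)
    (hd : ‖d‖ = 1) (hbc : 1 ≤ ‖b - c‖) (hcd : 1 ≤ ‖c - d‖) (hωbc : 0 < ω b c)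
    (hωcd : 0 < ω c d) (hhigh : ω c d < ω b d) :
    ‖b - c‖ = 1 ∧ ∃ r : ℝ, 1 < r ∧ r ≤ 2 ∧ b + d = r • c := by
  have := h.neg.add_eq_smul_of_high_left hd hc hb (by rwa [norm_sub_rev])
    (by rwa [norm_sub_rev]) (by simpa [h.swap c d] using hωcd)
    (by simpa [h.swap b c] using hωbc) (by simpa [h.swap c d, h.swap b d] using hhigh)
  rwa [norm_sub_rev, add_comm] at this

/-- Otherwise `ω a c * ω b d ≤ ω a b * ω c d`, while the Plücker relation makes the left product
larger by `ω a d * ω b c > 0`. Geometrically, `a` and `d` would be at least a half turn apart. -/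
theorem high_left_or_high_right (h : IsAreaForm ω) {a b c d : F} (hab : 0 < ω a b)
    (hbc : 0 < ω b c) (hbd : 0 ≤ ω b d) (had : 0 < ω a d) :
    ω a b < ω a c ∨ ω c d < ω b d := by
  by_contra! hcon
  have := h.plucker a b c d
  nlinarith [mul_le_mul hcon.1 hcon.2 hbd hab.le, mul_pos had hbc]

/-- Of four separated unit vectors in an open half plane, the middle two are at distance `1`,
and one of them is a multiple of the sum of its neighbours. -/
theorem add_eq_smul_of_chain (h : IsAreaForm ω) {a b c d : F} (ha : ‖a‖ = 1) (hb : ‖b‖ = 1)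
    (hc : ‖c‖ = 1) (hd : ‖d‖ = 1) (hab : 1 ≤ ‖a - b‖) (hbc : 1 ≤ ‖b - c‖) (hcd : 1 ≤ ‖c - d‖)
    (hωab : 0 < ω a b) (hωbc : 0 < ω b c) (hωcd : 0 < ω c d) (hωbd : 0 < ω b d)
    (hωad : 0 < ω a d) :
    ‖b - c‖ = 1 ∧ ((∃ r : ℝ, 1 < r ∧ r ≤ 2 ∧ a + c = r • b) ∨
      ∃ r : ℝ, 1 < r ∧ r ≤ 2 ∧ b + d = r • c) := by
  rcases h.high_left_or_high_right hωab hωbc hωbd.le hωad with h1 | h1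
  · obtain ⟨h2, h3⟩ := h.add_eq_smul_of_high_left ha hb hc hab hbc hωab hωbc h1
    exact ⟨h2, .inl h3⟩
  · obtain ⟨h2, h3⟩ := h.add_eq_smul_of_high_right hb hc hd hbc hcd hωbc hωcd h1
    exact ⟨h2, .inr h3⟩

/-- A unit vector strictly between `-c` and `b`, where `b + c = r m`, lies on the segment from
`-c` to `b`. -/
theorem eq_sub_smul_of_add_eq_smul (h : IsAreaForm ω) {a b m c : F} (ha : ‖a‖ = 1)
    (hb : ‖b‖ = 1) (hc : ‖c‖ = 1) (hmc : 1 ≤ ‖m - c‖) {r : ℝ} (hr : 1 < r) (hm : b + c = r • m)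
    (hab : 0 < ω a b) (hbm : 0 < ω b m) (hac : 0 < ω a c) :
    ∃ τ : ℝ, 0 < τ ∧ a = b - τ • m := by
  have ec : c = r • m - b := eq_sub_of_add_eq' hm
  have ea : ω b m • a = ω a m • b - ω a b • m := h.cramer a b m
  have e1 : ω a c = r * ω a m - ω a b := by
    rw [ec, map_sub, map_smul, smul_eq_mul]
  have hα : 0 < ω a m := by nlinarith
  -- Chosen so that `b - τ m` is on the ray of `a`; both being unit vectors, they coincide.
  set τ := ω a b / ω a m with hτ
  have hτ0 : 0 < τ := div_pos hab hα
  have hτr : τ < r := by rw [hτ, div_lt_iff₀ hα]; linarith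
  have hn : ‖b - τ • m‖ = 1 := by
    have := norm_eq_one_of_add_eq_smul hb hc hmc hr hm (t := r - τ) ⟨by linarith, by linarith⟩
    rwa [ec, show -(r • m - b) + (r - τ) • m = b - τ • m by module] at this
  have e2 : ω b m • a = ω a m • (b - τ • m) := by
    rw [ea, smul_sub, smul_smul, hτ, mul_div_cancel₀ _ hα.ne']
  have e3 : ω b m = ω a m := by
    have := congrArg norm e2
    rwa [norm_smul, norm_smul, ha, hn, mul_one, mul_one, Real.norm_of_nonneg hbm.le,
      Real.norm_of_nonneg hα.le] at this
  refine ⟨τ, hτ0, ?_⟩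
  rw [e3] at e2
  exact smul_right_injective F hα.ne' e2

/-- Five separated unit vectors in a closed half plane force the unit ball to be a
parallelogram, and the first and the last one are antipodal. -/
theorem hasSquareBall_of_chain (h : IsAreaForm ω) {g : Fin 5 → F} (hg : ∀ i, ‖g i‖ = 1)
    (hsep : ∀ i j, i ≠ j → 1 ≤ ‖g i - g j‖)
    (hord : ∀ i j, i < j → (i ≠ 0 ∨ j ≠ 4) → 0 < ω (g i) (g j)) (h04 : 0 ≤ ω (g 0) (g 4)) :
    HasSquareBall F ∧ ω (g 0) (g 4) = 0 := by
  have o01 := hord 0 1 (by decide) (by decide)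
  have o02 := hord 0 2 (by decide) (by decide)
  have o03 := hord 0 3 (by decide) (by decide)
  have o12 := hord 1 2 (by decide) (by decide)
  have o13 := hord 1 3 (by decide) (by decide)
  have o14 := hord 1 4 (by decide) (by decide)
  have o23 := hord 2 3 (by decide) (by decide)
  have o24 := hord 2 4 (by decide) (by decide)
  have o34 := hord 3 4 (by decide) (by decide)
  have s01 := hsep 0 1 (by decide)
  have s12 := hsep 1 2 (by decide)
  have s23 := hsep 2 3 (by decide)
  have s34 := hsep 3 4 (by decide)
  have n0 := hg 0
  have n1 := hg 1
  have n2 := hg 2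
  have n3 := hg 3
  have n4 := hg 4
  generalize g 0 = a at *
  generalize g 1 = b at *
  generalize g 2 = c at *
  generalize g 3 = d at *
  generalize g 4 = e at *
  obtain ⟨nbc, hbc⟩ := h.add_eq_smul_of_chain n0 n1 n2 n3 s01 s12 s23 o01 o12 o23 o13 o03
  obtain ⟨ncd, hcd⟩ := h.add_eq_smul_of_chain n1 n2 n3 n4 s12 s23 s34 o12 o23 o34 o24 o14
  have mid : (∃ r : ℝ, 1 < r ∧ r ≤ 2 ∧ b + d = r • c) → HasSquareBall F ∧ ω a e = 0 := by
    rintro ⟨r, hr1, hr2, hr⟩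
    obtain ⟨τ, hτ, ea⟩ := h.eq_sub_smul_of_add_eq_smul n0 n1 n3 s23 hr1 hr o01 o12 o03
    obtain ⟨σ, hσ, ee⟩ := h.neg.eq_sub_smul_of_add_eq_smul (a := e) n4 n3 n1
      (by rwa [norm_sub_rev]) hr1 (by rwa [add_comm])
      (by simpa [h.swap d e] using o34) (by simpa [h.swap c d] using o23)
      (by simpa [h.swap b e] using o14)
    have hτ1 : 1 ≤ τ := by
      rw [ea, sub_sub_cancel_left, norm_neg, norm_smul, n2, Real.norm_of_nonneg hτ.le] at s01
      linarith
    have hσ1 : 1 ≤ σ := by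
      rw [ee, sub_sub_cancel, norm_smul, n2, Real.norm_of_nonneg hσ.le] at s34
      linarith
    have ed : d = r • c - b := eq_sub_of_add_eq' hr
    -- Here `τ, σ ≥ 1` and `r ≤ 2`, while the angular order gives `ω a e ≥ 0`, so all these
    -- inequalities are equalities.
    have hω : ω a e = (r - σ - τ) * ω b c := by
      rw [ea, ee, ed]
      simp only [map_sub, map_smul, LinearMap.sub_apply, LinearMap.smul_apply, smul_eq_mul,
        h.self, h.swap b c]
      ring
    have hsum : 0 ≤ r - σ - τ := by
      by_contra! hneg
      nlinarith
    obtain rfl : τ = 1 := by linarith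
    obtain rfl : σ = 1 := by linarith
    obtain rfl : r = 2 := by linarith
    refine ⟨⟨b - c, c, nbc, n2, ?_, ?_⟩, by rw [hω]; ring⟩
    · rw [sub_add_cancel, n1]
    · have : b - c - c = -d := by rw [ed]; module
      rw [this, norm_neg, n3]
  rcases hbc with ⟨r, hr1, hr2, hr⟩ | hbc
  · rcases hcd with hcd | ⟨s, hs1, hs2, hs⟩
    · exact mid hcd
    have ea : a = r • b - c := eq_sub_of_add_eq hr
    have ee : e = s • d - c := eq_sub_of_add_eq' hs
    set lam := ω c d / ω b d with hlam
    set mu := ω b c / ω b d with hmu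
    have ec : c = lam • b + mu • d := by
      have := h.cramer c b d
      rw [h.swap b c] at this
      rw [hlam, hmu, div_eq_inv_mul, div_eq_inv_mul, mul_smul, mul_smul, ← smul_add,
        ← sub_neg_eq_add, ← neg_smul, ← this, smul_smul, inv_mul_cancel₀ o13.ne', one_smul]
    have hlam0 : 0 < lam := div_pos o23 o13
    have hmu0 : 0 < mu := div_pos o12 o13
    -- The line through `-c` parallel to `b` carries a segment of the sphere, so it misses the open
    -- ball; it contains `-(mu d)`.
    have hmu1 : 1 ≤ mu := by
      have := one_le_norm_line (x := -c) (w := b) zero_lt_one hr1 (by simp [n2])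
        (by rw [← hr]; simp [n0]) (by rw [one_smul, neg_add_eq_sub]; exact s12) lam
      rw [ec, show -(lam • b + mu • d) + lam • b = -(mu • d) by module, norm_neg, norm_smul, n3,
        Real.norm_of_nonneg hmu0.le] at this
      linarith
    have hlam1 : 1 ≤ lam := by
      have := one_le_norm_line (x := -c) (w := d) zero_lt_one hs1 (by simp [n2])
        (by rw [← hs]; simp [n4])
        (by rw [one_smul, neg_add_eq_sub, norm_sub_rev]; exact s23) mu
      rw [ec, show -(lam • b + mu • d) + mu • d = -(lam • b) by module, norm_neg, norm_smul, n1,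
        Real.norm_of_nonneg hlam0.le] at this
      linarith
    have hω : ω a e = (r * s - r * mu - s * lam) * ω b d := by
      have e1 : ω a e = r * s * ω b d - r * ω b c - s * ω c d := by
        rw [ea, ee]
        simp only [map_sub, map_smul, LinearMap.sub_apply, LinearMap.smul_apply, smul_eq_mul,
          h.self]
        ring
      rw [e1, hlam, hmu]
      field_simp
    have hsum : 0 ≤ r * s - r * mu - s * lam := by
      by_contra! hneg
      nlinarith
    -- From `lam, mu ≥ 1` and `hsum` follows `(r - 1)(s - 1) ≥ 1`, while both factors are at most 1.
    have hr2' : r = 2 := by nlinarith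
    have hs2' : s = 2 := by nlinarith
    subst hr2' hs2'
    have hl : lam = 1 := by linarith
    have hm : mu = 1 := by linarith
    rw [hl, hm, one_smul, one_smul] at ec
    refine ⟨⟨b, d, n1, n3, ?_, ?_⟩, by rw [hω, hl, hm]; ring⟩
    · rw [← ec, n2]
    · have : b - d = a := by rw [ea, ec]; module
      rw [this, n0]
  · exact mid hbc

end IsAreaForm

end Chains

/-! ### Upper bounds by counting. -/

section UpperBounds

theorem Finset.ne_zero_of_norm_eq_one {F : Type*} [NormedAddCommGroup F] {s : Finset F}
    (hs : ∀ v ∈ s, ‖v‖ = 1) {p : F} (hp : p ∈ s) : p ≠ 0 := by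
  rintro rfl; simpa using hs 0 hp

variable {F : Type*} [NormedAddCommGroup F] [NormedSpace ℝ F]

theorem ne_neg_of_ne_zero {p : F} (hp : p ≠ 0) : p ≠ -p := fun e => hp <| by
  have : (2 : ℝ) • p = 0 := by rw [two_smul]; nth_rewrite 1 [e]; exact neg_add_cancel p
  simpa using this

theorem Finset.card_filter_trichotomy {α : Type*} (s : Finset α) (f : α → ℝ) :
    (s.filter fun v => 0 < f v).card + (s.filter fun v => f v < 0).card +
      (s.filter fun v => f v = 0).card = s.card ∧
    (s.filter fun v => 0 ≤ f v).card =
      (s.filter fun v => 0 < f v).card + (s.filter fun v => f v = 0).card ∧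
    (s.filter fun v => f v ≤ 0).card =
      (s.filter fun v => f v < 0).card + (s.filter fun v => f v = 0).card := by
  classical
  have h1 : (s.filter fun v => 0 ≤ f v).card =
      (s.filter fun v => 0 < f v).card + (s.filter fun v => f v = 0).card := by
    rw [← Finset.card_union_of_disjoint]
    · congr 1; ext v; simp only [Finset.mem_filter, Finset.mem_union, le_iff_lt_or_eq, eq_comm]
      tauto
    · rw [Finset.disjoint_filter]; intro v _ h h'; linarith
  have h2 : (s.filter fun v => f v ≤ 0).card =
      (s.filter fun v => f v < 0).card + (s.filter fun v => f v = 0).card := by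
    rw [← Finset.card_union_of_disjoint]
    · congr 1; ext v; simp only [Finset.mem_filter, Finset.mem_union, le_iff_lt_or_eq]
      tauto
    · rw [Finset.disjoint_filter]; intro v _ h h'; linarith
  refine ⟨?_, h1, h2⟩
  have h3 := Finset.card_filter_add_card_filter_not (s := s) (fun v => 0 ≤ f v)
  simp only [not_le] at h3
  omega

namespace IsAreaForm

variable {ω : F →ₗ[ℝ] F →ₗ[ℝ] ℝ}

theorem form_ne_zero (h : IsAreaForm ω) {p : F} (hp : p ≠ 0) : ω p ≠ 0 := by
  obtain ⟨y, hy⟩ := h.nondegenerate p hp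
  intro h0; rw [h0] at hy; simp at hy

/-- An angular enumeration without antipodal vectors is strict. -/
theorem exists_strict_angular_enum (h : IsAreaForm ω) {f : F →ₗ[ℝ] ℝ} (hf : f ≠ 0)
    (s : Finset F) (hs : ∀ v ∈ s, ‖v‖ = 1) (hsf : ∀ v ∈ s, 0 ≤ f v) (hneg : ∀ v ∈ s, -v ∉ s)
    {n : ℕ} (hn : s.card = n) :
    ∃ g : Fin n → F, Function.Injective g ∧ (∀ i, g i ∈ s) ∧
      ∀ i j, i < j → 0 < ω (g i) (g j) := by
  obtain ⟨g, hinj, hg, hord⟩ := h.exists_angular_enum hf s hs hsf hn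
  refine ⟨g, hinj, hg, fun i j hij => lt_of_le_of_ne (hord i j hij) fun h0 => ?_⟩
  rcases h.eq_or_eq_neg (hs _ (hg i)) (hs _ (hg j)) h0.symm with e | e
  · exact hij.ne' (hinj e)
  · exact hneg _ (hg i) (e ▸ hg j)

theorem add_eq_smul_of_card_eq_four (h : IsAreaForm ω) {f : F →ₗ[ℝ] ℝ} (hf : f ≠ 0)
    (s : Finset F) (hs : IsSeparated (s : Set F)) (hsf : ∀ v ∈ s, 0 ≤ f v)
    (hneg : ∀ v ∈ s, -v ∉ s) (hn : s.card = 4) :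
    ∃ a ∈ s, ∃ b ∈ s, ∃ c ∈ s, a ≠ b ∧ ‖a - b‖ = 1 ∧ ∃ r : ℝ, 1 < r ∧ c + b = r • a := by
  obtain ⟨g, hinj, hg, hord⟩ := h.exists_strict_angular_enum hf s hs.1 hsf hneg hn
  have sep : ∀ i j, i ≠ j → 1 ≤ ‖g i - g j‖ := fun i j hij =>
    hs.2 (hg i) (hg j) fun e => hij (hinj e)
  obtain ⟨n12, ⟨r, hr1, _, hr⟩ | ⟨r, hr1, _, hr⟩⟩ :=
    h.add_eq_smul_of_chain (hs.1 _ (hg 0)) (hs.1 _ (hg 1)) (hs.1 _ (hg 2))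
    (hs.1 _ (hg 3)) (sep 0 1 (by decide)) (sep 1 2 (by decide)) (sep 2 3 (by decide))
    (hord 0 1 (by decide)) (hord 1 2 (by decide)) (hord 2 3 (by decide)) (hord 1 3 (by decide))
    (hord 0 3 (by decide))
  · exact ⟨g 1, hg 1, g 2, hg 2, g 0, hg 0, fun e => absurd (hinj e) (by decide), n12, r, hr1, hr⟩
  · exact ⟨g 2, hg 2, g 1, hg 1, g 3, hg 3, fun e => absurd (hinj e) (by decide),
      by rwa [norm_sub_rev], r, hr1, by rwa [add_comm]⟩

theorem hasLongSide_of_card_eq_four (h : IsAreaForm ω) {f : F →ₗ[ℝ] ℝ} (hf : f ≠ 0)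
    (s : Finset F) (hs : IsSeparated (s : Set F)) (hsf : ∀ v ∈ s, 0 < f v) (hn : s.card = 4) :
    HasLongSide F := by
  obtain ⟨a, ha, b, hb, c, hc, hab, -, r, hr, e⟩ := h.add_eq_smul_of_card_eq_four hf s hs
    (fun v hv => (hsf v hv).le)
    (fun v hv hv' => by have := hsf _ hv'; rw [map_neg] at this; linarith [hsf v hv]) hn
  exact hasLongSide_of_add_eq_smul (hs.1 c hc) (hs.1 a ha) (hs.1 b hb) (hs.2 ha hb hab) hr e

theorem hasSquareBall_of_card_eq_five (h : IsAreaForm ω) {f : F →ₗ[ℝ] ℝ} (hf : f ≠ 0)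
    (s : Finset F) (hs : IsSeparated (s : Set F)) (hsf : ∀ v ∈ s, 0 ≤ f v) (hn : s.card = 5) :
    HasSquareBall F := by
  obtain ⟨g, hinj, hg, hord⟩ := h.exists_angular_enum hf s hs.1 hsf hn
  refine (h.hasSquareBall_of_chain (fun i => hs.1 _ (hg i))
    (fun i j hij => hs.2 (hg i) (hg j) fun e => hij (hinj e))
    (fun i j hij hk => ?_) (hord 0 4 (by decide))).1
  rcases hk with hk | hk
  · exact h.pos_of_angular_enum hinj (fun i => hs.1 _ (hg i)) hord (k := 0) hij
      (.inl (Fin.pos_of_ne_zero hk))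
  · exact h.pos_of_angular_enum hinj (fun i => hs.1 _ (hg i)) hord (k := 4) hij
      (.inr (by omega))

/-- Five vectors would make the ends of the chain antipodal. This bounds open half planes and also
handles the extremal case of nine vectors. -/
theorem card_ne_five_of_neg_notMem (h : IsAreaForm ω) {f : F →ₗ[ℝ] ℝ} (hf : f ≠ 0)
    (s : Finset F) (hs : IsSeparated (s : Set F)) (hsf : ∀ v ∈ s, 0 ≤ f v)
    (hneg : ∀ v ∈ s, -v ∉ s) : s.card ≠ 5 := by
  intro hn
  obtain ⟨g, hinj, hg, hord⟩ := h.exists_strict_angular_enum hf s hs.1 hsf hneg hn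
  have := (h.hasSquareBall_of_chain (fun i => hs.1 _ (hg i))
    (fun i j hij => hs.2 (hg i) (hg j) fun e => hij (hinj e))
    (fun i j hij _ => hord i j hij) (hord 0 4 (by decide)).le).2
  exact (hord 0 4 (by decide)).ne' this

/-- The sixth vector keeps the first and the fifth from being antipodal, against the equality case
of the chain formed by the first five. -/
theorem card_ne_six_of_halfPlane (h : IsAreaForm ω) {f : F →ₗ[ℝ] ℝ} (hf : f ≠ 0)
    (s : Finset F) (hs : IsSeparated (s : Set F)) (hsf : ∀ v ∈ s, 0 ≤ f v) : s.card ≠ 6 := by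
  intro hn
  obtain ⟨g, hinj, hg, hord⟩ := h.exists_angular_enum hf s hs.1 hsf hn
  have pos : ∀ i j : Fin 5, i < j → 0 < ω (g i.castSucc) (g j.castSucc) := fun i j hij =>
    h.pos_of_angular_enum hinj (fun i => hs.1 _ (hg i)) hord (k := Fin.last 5)
      (by simpa using hij) (.inr (Fin.castSucc_lt_last j))
  have := (h.hasSquareBall_of_chain (g := fun i => g i.castSucc) (fun i => hs.1 _ (hg _))
    (fun i j hij => hs.2 (hg _) (hg _) fun e => hij (Fin.castSucc_injective _ (hinj e)))
    (fun i j hij _ => pos i j hij) (pos 0 4 (by decide)).le).2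
  exact (pos 0 4 (by decide)).ne' this

theorem card_le_of_halfPlane (h : IsAreaForm ω) {f : F →ₗ[ℝ] ℝ} (hf : f ≠ 0) (s : Finset F)
    (hs : IsSeparated (s : Set F)) (hsf : ∀ v ∈ s, 0 ≤ f v) :
    s.card ≤ 5 ∧ (¬ HasSquareBall F → s.card ≤ 4) := by
  constructor
  · by_contra! hlt
    obtain ⟨t, ht, htn⟩ := Finset.exists_subset_card_eq (Nat.succ_le_of_lt hlt)
    exact h.card_ne_six_of_halfPlane hf t (hs.mono (by exact_mod_cast ht))
      (fun v hv => hsf v (ht hv)) htn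
  · intro hsq
    by_contra! hlt
    obtain ⟨t, ht, htn⟩ := Finset.exists_subset_card_eq (Nat.succ_le_of_lt hlt)
    exact hsq (h.hasSquareBall_of_card_eq_five hf t (hs.mono (by exact_mod_cast ht))
      (fun v hv => hsf v (ht hv)) htn)

theorem card_filter_form_eq_zero (h : IsAreaForm ω) {s : Finset F} (hs : ∀ v ∈ s, ‖v‖ = 1)
    {p : F} (hp : p ∈ s) :
    1 ≤ (s.filter fun v => ω p v = 0).card ∧ (s.filter fun v => ω p v = 0).card ≤ 2 ∧
      (-p ∈ s ↔ 2 ≤ (s.filter fun v => ω p v = 0).card) := by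
  classical
  have hsub : (s.filter fun v => ω p v = 0) ⊆ {p, -p} := fun v hv => by
    rw [Finset.mem_filter] at hv
    simpa using h.eq_or_eq_neg (hs p hp) (hs v hv.1) hv.2
  have hpm : p ∈ s.filter fun v => ω p v = 0 := by simp [hp, h.self]
  have hne : p ≠ -p := ne_neg_of_ne_zero (Finset.ne_zero_of_norm_eq_one hs hp)
  refine ⟨Finset.card_pos.2 ⟨p, hpm⟩, (Finset.card_le_card hsub).trans Finset.card_le_two,
    fun hm => ?_, fun hc => ?_⟩
  · rw [← Finset.card_pair hne]
    refine Finset.card_le_card fun v hv => ?_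
    rcases Finset.mem_insert.1 hv with rfl | hv
    · exact hpm
    · rw [Finset.mem_singleton.1 hv]; simp [hm, h.self]
  · by_contra hm
    have : (s.filter fun v => ω p v = 0) ⊆ {p} := fun v hv => by
      have := hsub hv
      simp only [Finset.mem_insert, Finset.mem_singleton] at this ⊢
      rcases this with rfl | rfl
      · rfl
      · exact absurd (Finset.mem_filter.1 hv).1 hm
    have := Finset.card_le_card this
    rw [Finset.card_singleton] at this
    omega

theorem neg_notMem_filter (h : IsAreaForm ω) {s : Finset F} (hs : ∀ v ∈ s, ‖v‖ = 1)
    {p : F} (hp : p ∈ s) (hpn : -p ∉ s) :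
    ∀ v ∈ s.filter (fun v => 0 ≤ ω p v), -v ∉ s.filter (fun v => 0 ≤ ω p v) := by
  intro v hv hv'
  rw [Finset.mem_filter] at hv hv'
  rw [map_neg] at hv'
  rcases h.eq_or_eq_neg (hs p hp) (hs v hv.1) (by linarith [hv.2, hv'.2]) with rfl | rfl
  · exact hpn hv'.1
  · exact hpn hv.1

theorem card_closed_le (h : IsAreaForm ω) {s : Finset F}
    {n : ℕ} (hn : ∀ (f : F →ₗ[ℝ] ℝ), f ≠ 0 → ∀ t ⊆ s, (∀ v ∈ t, 0 ≤ f v) → t.card ≤ n) {p : F}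
    (hp : p ≠ 0) :
    (s.filter fun v => 0 ≤ ω p v).card ≤ n ∧ (s.filter fun v => ω p v ≤ 0).card ≤ n := by
  refine ⟨hn (ω p) (h.form_ne_zero hp) _ (Finset.filter_subset _ _) fun v hv =>
    (Finset.mem_filter.1 hv).2, hn (-ω p) (neg_ne_zero.2 (h.form_ne_zero hp)) _
    (Finset.filter_subset _ _) fun v hv => ?_⟩
  simpa using (Finset.mem_filter.1 hv).2

/-- Two closed half planes of at most five vectors share the line through `p`, so that line contains
only `p` and each side is full; but five vectors without an antipodal pair are impossible. -/
theorem card_ne_nine (h : IsAreaForm ω) (s : Finset F) (hs : IsSeparated (s : Set F)) :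
    s.card ≠ 9 := by
  intro hn
  obtain ⟨p, hp⟩ : s.Nonempty := Finset.card_pos.1 (by omega)
  have hp0 := Finset.ne_zero_of_norm_eq_one hs.1 hp
  obtain ⟨h1, h2⟩ := h.card_closed_le (n := 5) (fun f hf t ht htf =>
    (h.card_le_of_halfPlane hf t (hs.mono (by exact_mod_cast ht)) htf).1) hp0
  obtain ⟨h3, h4, h5⟩ := s.card_filter_trichotomy (ω p)
  obtain ⟨h6, -, h7⟩ := h.card_filter_form_eq_zero hs.1 hp
  have hpn : -p ∉ s := by rw [h7]; omega
  exact h.card_ne_five_of_neg_notMem (h.form_ne_zero hp0) (s.filter fun v => 0 ≤ ω p v)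
    (hs.mono (by exact_mod_cast Finset.filter_subset _ _))
    (fun v hv => (Finset.mem_filter.1 hv).2) (h.neg_notMem_filter hs.1 hp hpn) (by omega)

/-- The next vector in angular order. -/
theorem exists_next (h : IsAreaForm ω) {s : Finset F} (hs : ∀ v ∈ s, ‖v‖ = 1) {p : F}
    (hL : (s.filter fun v => 0 < ω p v).Nonempty) :
    ∃ q ∈ s, 0 < ω p q ∧ ∀ z ∈ s, 0 < ω p z → 0 ≤ ω q z := by
  have hf : ω p ≠ 0 := by
    obtain ⟨v, hv⟩ := hL
    intro h0
    have := (Finset.mem_filter.1 hv).2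
    rw [h0] at this; simp at this
  obtain ⟨k, hk⟩ : ∃ k, (s.filter fun v => 0 < ω p v).card = k + 1 :=
    Nat.exists_eq_succ_of_ne_zero (Finset.card_pos.2 hL).ne'
  obtain ⟨g, hinj, hg, hord⟩ := h.exists_angular_enum hf (s.filter fun v => 0 < ω p v)
    (fun v hv => hs v (Finset.mem_filter.1 hv).1)
    (fun v hv => (Finset.mem_filter.1 hv).2.le) hk
  have hsurj : ∀ z ∈ s.filter (fun v => 0 < ω p v), ∃ i, g i = z := by
    intro z hz
    obtain ⟨i, -, hi⟩ := Finset.surj_on_of_inj_on_of_card_le (s := Finset.univ)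
      (fun i _ => g i) (fun i _ => hg i) (fun i j _ _ e => hinj e) (by simp [hk]) z hz
    exact ⟨i, hi.symm⟩
  refine ⟨g 0, (Finset.mem_filter.1 (hg 0)).1, (Finset.mem_filter.1 (hg 0)).2,
    fun z hz hpz => ?_⟩
  obtain ⟨i, rfl⟩ := hsurj z (by simp [hz, hpz])
  rcases (Fin.zero_le i).eq_or_lt with e | e
  · rw [← e, h.self]
  · exact hord 0 i e

/-- An odd cycle has no proper 2-colouring. With `σ` the cyclic successor and `G` the vectors that
are a multiple, with factor greater than 1, of the sum of their neighbours, each pair `p`, `σ p` has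
exactly one member in `G`. -/
theorem card_ne_seven (h : IsAreaForm ω) (hsq : ¬ HasSquareBall F) (s : Finset F)
    (hs : IsSeparated (s : Set F)) : s.card ≠ 7 := by
  classical
  intro hn
  have half : ∀ {w : F}, w ≠ 0 → (s.filter fun v => 0 ≤ ω w v).card ≤ 4 ∧
      (s.filter fun v => ω w v ≤ 0).card ≤ 4 := fun hw =>
    h.card_closed_le (n := 4) (fun f hf t ht htf =>
      (h.card_le_of_halfPlane hf t (hs.mono (by exact_mod_cast ht)) htf).2 hsq) hw
  have cards : ∀ p ∈ s, -p ∉ s ∧ (s.filter fun v => 0 < ω p v).card = 3 := by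
    intro p hp
    obtain ⟨h1, h2⟩ := half (Finset.ne_zero_of_norm_eq_one hs.1 hp)
    obtain ⟨h3, h4, h5⟩ := s.card_filter_trichotomy (ω p)
    obtain ⟨h6, -, h7⟩ := h.card_filter_form_eq_zero hs.1 hp
    exact ⟨by rw [h7]; omega, by omega⟩
  have hne : ∀ p ∈ s, ∀ q ∈ s, p ≠ q → ω p q ≠ 0 := by
    intro p hp q hq hpq h0
    rcases h.eq_or_eq_neg (hs.1 p hp) (hs.1 q hq) h0 with e | e
    · exact hpq e.symm
    · exact (cards p hp).1 (e ▸ hq)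
  have hnext : ∀ p, ∃ q, p ∈ s → q ∈ s ∧ 0 < ω p q ∧ ∀ z ∈ s, 0 < ω p z → 0 ≤ ω q z := by
    intro p
    by_cases hp : p ∈ s
    · obtain ⟨q, hq⟩ := h.exists_next hs.1
        (Finset.card_pos.1 (by rw [(cards p hp).2]; norm_num) :
          (s.filter fun v => 0 < ω p v).Nonempty)
      exact ⟨q, fun _ => hq⟩
    · exact ⟨0, fun hp' => absurd hp' hp⟩
  choose σ hσ using hnext
  have hσs : ∀ p ∈ s, σ p ∈ s := fun p hp => (hσ p hp).1
  have hσpos : ∀ p ∈ s, 0 < ω p (σ p) := fun p hp => (hσ p hp).2.1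
  have hσmin : ∀ p ∈ s, ∀ z ∈ s, 0 < ω p z → 0 ≤ ω (σ p) z := fun p hp => (hσ p hp).2.2
  -- If `σ p = σ q` with `q` to the left of `p`, then `q` would come no earlier than `σ p` yet
  -- strictly before `σ q`.
  have hσinj : Set.InjOn σ s := by
    have aux : ∀ p ∈ s, ∀ q ∈ s, σ p = σ q → ¬ 0 < ω p q := by
      intro p hp q hq e hpq
      have h1 := hσmin p hp q hq hpq
      have h2 := hσpos q hq
      rw [e, h.swap] at h1
      linarith
    intro p hp q hq e
    by_contra hpq
    rcases lt_or_gt_of_ne (hne p hp q hq hpq) with h1 | h1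
    · exact aux q hq p hp e.symm (by rw [h.swap]; linarith)
    · exact aux p hp q hq e h1
  have hσsurj : ∀ p ∈ s, ∃ a ∈ s, σ a = p := by
    have : s.image σ = s := Finset.eq_of_subset_of_card_le
      (fun x hx => by obtain ⟨a, ha, rfl⟩ := Finset.mem_image.1 hx; exact hσs a ha)
      (by rw [Finset.card_image_of_injOn hσinj])
    intro p hp
    rw [← this] at hp
    exact Finset.mem_image.1 hp
  have sep : ∀ p ∈ s, ∀ q ∈ s, 0 < ω p q → 1 ≤ ‖p - q‖ := fun p hp q hq hpq =>
    hs.2 hp hq (by rintro rfl; rw [h.self] at hpq; exact lt_irrefl _ hpq)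
  let G := s.filter fun p => ∃ a ∈ s, σ a = p ∧ ∃ r : ℝ, 1 < r ∧ a + σ p = r • p
  have edge : ∀ p ∈ s, p ∈ G ∨ σ p ∈ G := by
    intro p hp
    obtain ⟨a, ha, hap⟩ := hσsurj p hp
    set q := σ p with hq
    have hqs : q ∈ s := hσs p hp
    have hpq : 0 < ω p q := hσpos p hp
    have hap' : 0 < ω a p := by have := hσpos a ha; rwa [hap] at this
    have hqd : 0 < ω q (σ q) := hσpos q hqs
    have hds : σ q ∈ s := hσs q hqs
    have hw : p - q ≠ 0 := fun e => by
      rw [sub_eq_zero.1 e, h.self] at hpq; exact lt_irrefl _ hpq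
    have hω : ∀ z, ω (p - q) z = ω p z - ω q z := fun z => by
      rw [map_sub, LinearMap.sub_apply]
    have hwp : ω (p - q) p = ω p q := by rw [hω, h.self, h.swap p q]; ring
    have hwq : ω (p - q) q = ω p q := by rw [hω, h.self]; ring
    -- At most four vectors are in the opposite closed half plane, so at least three are on the side
    -- of `p` and `q`. According as the third comes before `p` or after, the predecessor of `p` or
    -- the successor of `q` is on that side too.
    obtain ⟨z, hz, hzpq⟩ : ∃ z ∈ s.filter (fun v => 0 < ω (p - q) v), z ∉ ({p, q} : Finset F) := by
      apply Finset.exists_mem_notMem_of_card_lt_card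
      have h1 := (half hw).2
      obtain ⟨h3, h4, h5⟩ := s.card_filter_trichotomy (ω (p - q))
      have h6 : ({p, q} : Finset F).card ≤ 2 := Finset.card_le_two
      omega
    obtain ⟨hzs, hwz⟩ := Finset.mem_filter.1 hz
    simp only [Finset.mem_insert, Finset.mem_singleton, not_or] at hzpq
    rcases lt_or_gt_of_ne (hne p hp z hzs (Ne.symm hzpq.1)) with h1 | h1
    · left
      have hza : ω a z ≤ 0 := by
        by_contra! hlt
        have := hσmin a ha z hzs hlt
        rw [hap] at this; linarith
      have hhigh : 0 < ω (p - q) a := by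
        by_contra! hle
        have := h.plucker (p - q) p a z
        rw [h.swap a p, hwp] at this
        nlinarith [mul_pos hwz hap', mul_nonneg_of_nonpos_of_nonpos hle h1.le]
      rw [hω, h.swap a p, h.swap a q] at hhigh
      obtain ⟨-, r, hr, -, e⟩ := h.add_eq_smul_of_high_left (hs.1 a ha) (hs.1 p hp)
        (hs.1 q hqs) (sep a ha p hp hap') (sep p hp q hqs hpq) hap' hpq (by linarith)
      exact Finset.mem_filter.2 ⟨hp, a, ha, hap, r, hr, e⟩
    · right
      have hqz : 0 < ω q z := lt_of_le_of_ne (hσmin p hp z hzs h1)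
        (Ne.symm (hne q hqs z hzs (Ne.symm hzpq.2)))
      have hdz := hσmin q hqs z hzs hqz
      have hhigh : 0 < ω (p - q) (σ q) := by
        by_contra! hle
        have := h.plucker (p - q) q (σ q) z
        rw [hwq] at this
        nlinarith [mul_pos hwz hqd, mul_nonneg hpq.le hdz, mul_nonneg (neg_nonneg.2 hle) hqz.le]
      rw [hω] at hhigh
      obtain ⟨-, r, hr, -, e⟩ := h.add_eq_smul_of_high_right (hs.1 p hp) (hs.1 q hqs)
        (hs.1 _ hds) (sep p hp q hqs hpq) (sep q hqs _ hds hqd) hpq hqd (by linarith)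
      exact Finset.mem_filter.2 ⟨hqs, p, hp, rfl, r, hr, e⟩
  have notboth : ∀ p ∈ s, ¬ (p ∈ G ∧ σ p ∈ G) := by
    rintro p hp ⟨h1, h2⟩
    obtain ⟨-, a, ha, -, r, hr, e⟩ := Finset.mem_filter.1 h1
    obtain ⟨-, b, hb, hbp, t, ht, e'⟩ := Finset.mem_filter.1 h2
    obtain rfl : b = p := hσinj hb hp hbp
    exact not_consecutive_add_eq_smul (hs.1 a ha) (hs.1 _ (hσs _ (hσs _ hp)))
      (sep _ hp _ (hσs _ hp) (hσpos _ hp)) hr ht e e'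
  have hGs : G ⊆ s := Finset.filter_subset _ _
  -- `σ` injects `G` into its complement and the complement into `G`; equal sizes contradict the odd
  -- total 7.
  have c1 : G.card ≤ (s \ G).card := by
    rw [← Finset.card_image_of_injOn (hσinj.mono (by exact_mod_cast hGs))]
    refine Finset.card_le_card fun x hx => ?_
    obtain ⟨p, hp, rfl⟩ := Finset.mem_image.1 hx
    exact Finset.mem_sdiff.2 ⟨hσs p (hGs hp), fun hG => notboth p (hGs hp) ⟨hp, hG⟩⟩
  have c2 : (s \ G).card ≤ G.card := by
    have hsub : s \ G ⊆ s := Finset.sdiff_subset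
    rw [← Finset.card_image_of_injOn (s := s \ G) (hσinj.mono (by exact_mod_cast hsub))]
    refine Finset.card_le_card fun x hx => ?_
    obtain ⟨p, hp, rfl⟩ := Finset.mem_image.1 hx
    obtain ⟨hp1, hp2⟩ := Finset.mem_sdiff.1 hp
    exact (edge p hp1).resolve_left hp2
  have c3 := Finset.card_sdiff_add_card_eq_card hGs
  omega

/-- Three vectors to the left of `p`, together with `p`, form four without antipodes in a closed
half plane, which forces a distance exactly 1. -/
theorem card_filter_pos_le_two (h : IsAreaForm ω) {s : Finset F}
    (hs : IsStrictlySeparated (s : Set F)) {p : F} (hp : p ∈ s) :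
    (s.filter fun v => 0 < ω p v).card ≤ 2 := by
  classical
  by_contra! hlt
  have hp0 := Finset.ne_zero_of_norm_eq_one hs.1 hp
  have hpL : p ∉ s.filter fun v => 0 < ω p v := by simp [h.self]
  obtain ⟨t, ht, htn⟩ := Finset.exists_subset_card_eq (Nat.succ_le_of_lt hlt)
  have hpt : p ∉ t := fun hm => hpL (ht hm)
  have hsub : insert p t ⊆ s :=
    Finset.insert_subset hp (ht.trans (Finset.filter_subset _ _))
  have hst : IsStrictlySeparated ((insert p t : Finset F) : Set F) :=
    hs.mono (Finset.coe_subset.2 hsub)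
  have hpos : ∀ v ∈ t, 0 < ω p v := fun v hv => (Finset.mem_filter.1 (ht hv)).2
  obtain ⟨a, ha, b, hb, -, -, hab, hn, -⟩ := h.add_eq_smul_of_card_eq_four (h.form_ne_zero hp0)
    (insert p t) hst.isSeparated (fun v hv => by
      rcases Finset.mem_insert.1 hv with rfl | hv
      · rw [h.self]
      · exact (hpos v hv).le)
    (fun v hv hv' => by
      have key : ∀ v ∈ insert p t, v = p ∨ 0 < ω p v := fun v hv =>
        (Finset.mem_insert.1 hv).imp_right (hpos v)
      rcases key v hv with rfl | h1 <;> rcases key _ hv' with h2 | h2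
      · exact ne_neg_of_ne_zero hp0 h2.symm
      · rw [map_neg, h.self] at h2; simp at h2
      · rw [neg_eq_iff_eq_neg.1 h2, map_neg, h.self] at h1; simp at h1
      · rw [map_neg] at h2; linarith)
    (by rw [Finset.card_insert_of_notMem hpt, htn])
  exact (hst.2 ha hb hab).ne' hn

/-- At most two vectors on each side of every line through a member makes the set symmetric: `±a,
±b, ±c`. Strictness excludes both rigid configurations, and the resulting comparisons along `a, b,
c, -a, -b` give `ω a b = ω a c = ω b c`, hence `a = b - c`. -/
theorem card_ne_six_of_strict (h : IsAreaForm ω) (s : Finset F)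
    (hs : IsStrictlySeparated (s : Set F)) : s.card ≠ 6 := by
  classical
  intro hn
  have cards : ∀ p ∈ s, -p ∈ s ∧ (s.filter fun v => 0 < ω p v).card = 2 := by
    intro p hp
    have h1 := h.card_filter_pos_le_two hs hp
    have h2 := h.neg.card_filter_pos_le_two hs hp
    simp only [LinearMap.neg_apply, Left.neg_pos_iff] at h2
    obtain ⟨h3, -, -⟩ := s.card_filter_trichotomy (ω p)
    obtain ⟨-, h6, h7⟩ := h.card_filter_form_eq_zero hs.1 hp
    exact ⟨by rw [h7]; omega, by omega⟩
  obtain ⟨a, ha⟩ : s.Nonempty := Finset.card_pos.1 (by omega)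
  obtain ⟨b, c, hbc, hL⟩ := Finset.card_eq_two.1 (cards a ha).2
  have mem : ∀ v, v = b ∨ v = c → v ∈ s ∧ 0 < ω a v := fun v hv => by
    have : v ∈ s.filter fun v => 0 < ω a v := by rw [hL]; simpa using hv
    exact Finset.mem_filter.1 this
  obtain ⟨hb, hab⟩ := mem b (.inl rfl)
  obtain ⟨hc, hac⟩ := mem c (.inr rfl)
  have main : ∀ b ∈ s, ∀ c ∈ s, 0 < ω a b → 0 < ω a c → 0 < ω b c → False := by
    intro b hb c hc hab hac hbc
    have sep : ∀ p ∈ s, ∀ q ∈ s, 0 < ω p q → 1 < ‖p - q‖ := fun p hp q hq hpq =>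
      hs.2 hp hq (by rintro rfl; rw [h.self] at hpq; exact lt_irrefl _ hpq)
    have cmp_left : ∀ p ∈ s, ∀ q ∈ s, ∀ r ∈ s, 0 < ω p q → 0 < ω q r → ω p r ≤ ω p q := by
      intro p hp q hq r hr hpq hqr
      by_contra! hlt
      exact (sep q hq r hr hqr).ne' (h.add_eq_smul_of_high_left (hs.1 p hp) (hs.1 q hq)
        (hs.1 r hr) (sep p hp q hq hpq).le (sep q hq r hr hqr).le hpq hqr hlt).1
    have cmp_right : ∀ p ∈ s, ∀ q ∈ s, ∀ r ∈ s, 0 < ω p q → 0 < ω q r → ω p r ≤ ω q r := by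
      intro p hp q hq r hr hpq hqr
      by_contra! hlt
      exact (sep p hp q hq hpq).ne' (h.add_eq_smul_of_high_right (hs.1 p hp) (hs.1 q hq)
        (hs.1 r hr) (sep p hp q hq hpq).le (sep q hq r hr hqr).le hpq hqr hlt).1
    have hna := (cards a ha).1
    have hnb := (cards b hb).1
    have e1 := cmp_left a ha b hb c hc hab hbc
    have e2 := cmp_right b hb c hc (-a) hna hbc (by rw [map_neg, h.swap a c]; linarith)
    have e3 := cmp_left b hb c hc (-a) hna hbc (by rw [map_neg, h.swap a c]; linarith)
    have e4 := cmp_right c hc (-a) hna (-b) hnb (by rw [map_neg, h.swap a c]; linarith)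
      (by simpa using hab)
    simp only [map_neg, LinearMap.neg_apply, neg_neg, h.swap a b, h.swap a c, h.swap b c]
      at e2 e3 e4
    have hcr := h.cramer a b c
    rw [show ω a c = ω a b by linarith, show ω b c = ω a b by linarith, ← smul_sub] at hcr
    have e5 : a = b - c := smul_right_injective F hab.ne' hcr
    have := sep b hb c hc hbc
    rw [← e5, hs.1 a ha] at this
    exact lt_irrefl _ this
  have hne : ω b c ≠ 0 := by
    intro h0
    rcases h.eq_or_eq_neg (hs.1 b hb) (hs.1 c hc) h0 with e | e
    · exact hbc e.symm
    · rw [e, map_neg] at hac; linarith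
  rcases lt_or_gt_of_ne hne with h1 | h1
  · exact main c hc b hb hac hab (by rw [h.swap]; linarith)
  · exact main b hb c hc hab hac h1

/-- Coordinates in which a norm with a parallelogram as unit ball is the maximum norm. -/
theorem exists_square_coord (h : IsAreaForm ω) {x y : F} (hx : ‖x‖ = 1) (hy : ‖y‖ = 1)
    (hxy : ‖x + y‖ ≤ 1) (hxy' : ‖x - y‖ ≤ 1) :
    ∃ α β : F →ₗ[ℝ] ℝ, α x = 1 ∧ α y = 0 ∧ β x = 0 ∧ β y = 1 ∧
      (∀ z, z = α z • x + β z • y) ∧ ∀ z, ‖z‖ = max |α z| |β z| := by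
  have hne : ω x y ≠ 0 := by
    intro h0
    rcases h.eq_or_eq_neg hx hy h0 with e | e
    · rw [e, ← two_smul ℝ, norm_smul, hx] at hxy; norm_num at hxy
    · rw [e, sub_neg_eq_add, ← two_smul ℝ, norm_smul, hx] at hxy'; norm_num at hxy'
  have hz : ∀ z, z = (-(ω x y)⁻¹ * ω y z) • x + ((ω x y)⁻¹ * ω x z) • y := by
    intro z
    have := h.cramer z x y
    rw [h.swap z y, h.swap z x]
    calc z = (ω x y)⁻¹ • (ω x y • z) := by rw [smul_smul, inv_mul_cancel₀ hne, one_smul]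
      _ = _ := by rw [this]; module
  refine ⟨-(ω x y)⁻¹ • ω y, (ω x y)⁻¹ • ω x, ?_, ?_, ?_, ?_, fun z => ?_, fun z => ?_⟩
  · simp [h.swap x y, hne]
  · simp [h.self]
  · simp [h.self]
  · simp [hne]
  · simpa using hz z
  · conv_lhs => rw [hz z]
    rw [norm_eq_max_of_square hx hy hxy hxy']
    simp

/-- Pigeonhole: two of the five share a quadrant of the square `[-1, 1]²`, and a quadrant has
diameter 1 in the maximum norm. -/
theorem card_ne_five_of_strict_of_square (h : IsAreaForm ω) (hsq : HasSquareBall F)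
    (s : Finset F) (hs : IsStrictlySeparated (s : Set F)) : s.card ≠ 5 := by
  classical
  intro hn
  obtain ⟨x, y, hx, hy, hxy, hxy'⟩ := hsq
  obtain ⟨α, β, -, -, -, -, -, hnorm⟩ := h.exists_square_coord hx hy hxy hxy'
  obtain ⟨v, hv, w, hw, hvw, e⟩ := Finset.exists_ne_map_eq_of_card_lt_of_maps_to
    (s := s) (t := (Finset.univ : Finset (Bool × Bool)))
    (f := fun v => (decide (0 ≤ α v), decide (0 ≤ β v))) (by rw [hn]; decide)
    (fun _ _ => Finset.mem_univ _)
  simp only [Prod.mk.injEq, decide_eq_decide] at e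
  have bound : ∀ v ∈ s, |α v| ≤ 1 ∧ |β v| ≤ 1 := fun v hv => by
    rw [← hs.1 v hv, hnorm v]; exact ⟨le_max_left _ _, le_max_right _ _⟩
  have close : ∀ {a b : ℝ}, |a| ≤ 1 → |b| ≤ 1 → (0 ≤ a ↔ 0 ≤ b) → |a - b| ≤ 1 := by
    intro a b ha hb hab
    rw [abs_le] at *
    rcases le_or_gt 0 a with h1 | h1
    · have := hab.1 h1; constructor <;> linarith
    · have : b < 0 := by by_contra! hb'; linarith [hab.2 hb']
      constructor <;> linarith
  have : 1 < ‖v - w‖ := hs.2 hv hw hvw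
  rw [hnorm, map_sub, map_sub] at this
  exact absurd this (not_lt.2 (max_le (close (bound v hv).1 (bound w hw).1 e.1)
    (close (bound v hv).2 (bound w hw).2 e.2)))

end IsAreaForm

end UpperBounds

/-! ### Constructions of separated families. -/

section LowerBounds

open Filter Topology

variable {F : Type*} [NormedAddCommGroup F]

theorem isSeparated_of_pairwise {l : List F} (h1 : ∀ v ∈ l, ‖v‖ = 1)
    (h2 : l.Pairwise fun v w => 1 ≤ ‖v - w‖) :
    IsSeparated {v | v ∈ l} ∧ Set.encard {v | v ∈ l} = l.length := by
  classical
  have : Std.Symm fun v w : F => 1 ≤ ‖v - w‖ := ⟨fun a b h => by rwa [norm_sub_rev]⟩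
  have hnd : l.Nodup := h2.imp (by rintro a b h rfl; simp at h; linarith)
  refine ⟨⟨h1, fun v hv w hw hvw => h2.forall hv hw hvw⟩, ?_⟩
  rw [← List.coe_toFinset, Set.encard_coe_eq_coe_finsetCard, List.toFinset_card_of_nodup hnd]

theorem isStrictlySeparated_of_pairwise {l : List F} (h1 : ∀ v ∈ l, ‖v‖ = 1)
    (h2 : l.Pairwise fun v w => 1 < ‖v - w‖) :
    IsStrictlySeparated {v | v ∈ l} ∧ Set.encard {v | v ∈ l} = l.length :=
  have : Std.Symm fun v w : F => 1 < ‖v - w‖ := ⟨fun a b h => by rwa [norm_sub_rev]⟩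
  ⟨⟨h1, fun v hv w hw hvw => h2.forall hv hw hvw⟩,
    (isSeparated_of_pairwise h1 (h2.imp le_of_lt)).2⟩

theorem eventually_one_lt_norm_sub {ι : Type*} {L : Filter ι} {f g : ι → F} {p q : F}
    (hf : Tendsto f L (𝓝 p)) (hg : Tendsto g L (𝓝 q)) (h : 1 < ‖p - q‖) :
    ∀ᶠ i in L, 1 < ‖f i - g i‖ :=
  (hf.sub hg).norm.eventually_const_lt h

variable [NormedSpace ℝ F]

/-- On the connected sphere the distance from `u` runs from 0 at `u` to 2 at `-u`. -/
theorem exists_hexagon (hF : 1 < Module.rank ℝ F) :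
    ∃ u v : F, ‖u‖ = 1 ∧ ‖v‖ = 1 ∧ ‖v - u‖ = 1 := by
  have : Nontrivial F := by
    by_contra hn
    rw [not_nontrivial_iff_subsingleton] at hn
    rw [rank_subsingleton'] at hF
    exact absurd hF (by simp)
  obtain ⟨u, hu⟩ := exists_norm_eq F zero_le_one
  have hconn := isPreconnected_sphere hF (0 : F) 1
  obtain ⟨v, hv, hvu⟩ := hconn.intermediate_value (a := u) (b := -u) (by simp [hu])
    (by simp [hu]) (f := fun v => ‖v - u‖) (by fun_prop) (show (1 : ℝ) ∈ _ by
      constructor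
      · simp
      · rw [← neg_add', norm_neg, ← two_smul ℝ, norm_smul, hu]; norm_num)
  exact ⟨u, v, hu, by simpa using hv, hvu⟩

theorem two_sub_le_of_norm {u v : F} (hu : ‖u‖ = 1) : 2 - ‖v - u‖ ≤ ‖v + u‖ := by
  have := norm_sub_le (v + u) (v - u)
  rw [show v + u - (v - u) = (2 : ℝ) • u by module, norm_smul, hu, Real.norm_ofNat] at this
  linarith

theorem exists_six (hF : 1 < Module.rank ℝ F) :
    ∃ V : Set F, IsSeparated V ∧ V.encard = 6 := by
  obtain ⟨u, v, hu, hv, huv⟩ := exists_hexagon hF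
  have key : ∀ p q : F, ‖p‖ = 1 → ‖q‖ = 1 → ‖p - q‖ = 1 → 1 ≤ ‖p + q‖ := fun p q hp hq h => by
    have := two_sub_le_of_norm (v := p) hq; linarith
  have h2 : ∀ p : F, ‖p‖ = 1 → 1 ≤ ‖p + p‖ := fun p hp => by
    rw [← two_smul ℝ, norm_smul, hp]; norm_num
  have huv' : ‖u - v‖ = 1 := by rwa [norm_sub_rev]
  have := isSeparated_of_pairwise (l := [u, v, v - u, -u, -v, u - v])
    (by simp [hu, hv, huv, huv']) (by
      simp only [List.pairwise_cons, List.mem_cons, List.not_mem_nil, or_false, forall_eq_or_imp,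
        forall_eq, IsEmpty.forall_iff, implies_true, List.Pairwise.nil, and_true]
      have e1 : 1 ≤ ‖u + v‖ := key u v hu hv huv'
      have e2 : 1 ≤ ‖v + (v - u)‖ := key _ _ hv huv (by simpa using hu)
      have e3 : 1 ≤ ‖u + (u - v)‖ := key _ _ hu huv' (by simpa using hv)
      refine ⟨⟨huv'.ge, ?_, ?_, ?_, ?_⟩, ⟨?_, ?_, ?_, ?_⟩, ⟨?_, ?_, ?_⟩, ⟨?_, ?_⟩, ?_⟩
      · rwa [show u - (v - u) = u + (u - v) by abel]
      · simpa using h2 u hu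
      · simpa using e1
      · simp [hv]
      · simp [hu]
      · rwa [sub_neg_eq_add, add_comm]
      · simpa using h2 v hv
      · rwa [show v - (u - v) = v + (v - u) by abel]
      · simp [hv]
      · rwa [show v - u - -v = v + (v - u) by abel]
      · rw [show v - u - (u - v) = (v - u) + (v - u) by abel]; exact h2 _ huv
      · rw [show -u - -v = v - u by abel, huv]
      · rwa [show -u - (u - v) = -(u + (u - v)) by abel, norm_neg]
      · rw [show -v - (u - v) = -u by abel, norm_neg, hu])
  exact ⟨_, this⟩

namespace IsAreaForm

variable {ω : F →ₗ[ℝ] F →ₗ[ℝ] ℝ}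

theorem hexagon_form_ne_zero (h : IsAreaForm ω) {u v : F} (hu : ‖u‖ = 1) (hv : ‖v‖ = 1)
    (huv : ‖v - u‖ = 1) : ω u v ≠ 0 := by
  intro h0
  rcases h.eq_or_eq_neg hu hv h0 with rfl | rfl
  · simp at huv
  · rw [← neg_add', norm_neg, ← two_smul ℝ, norm_smul, hu] at huv; norm_num at huv

theorem exists_four_closed (h : IsAreaForm ω) (hF : 1 < Module.rank ℝ F) :
    ∃ V : Set F, IsSeparated V ∧ V.encard = 4 ∧ ∃ f : F →ₗ[ℝ] ℝ, f ≠ 0 ∧ ∀ v ∈ V, 0 ≤ f v := by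
  obtain ⟨u, v, hu, hv, huv⟩ := exists_hexagon hF
  have hω := h.hexagon_form_ne_zero hu hv huv
  have := isSeparated_of_pairwise (l := [u, v, v - u, -u])
    (by simp [hu, hv, huv]) (by
      simp only [List.pairwise_cons, List.mem_cons, List.not_mem_nil, or_false, forall_eq_or_imp,
        forall_eq, IsEmpty.forall_iff, implies_true, List.Pairwise.nil, and_true]
      have huv' : ‖u - v‖ = 1 := by rwa [norm_sub_rev]
      refine ⟨⟨huv'.ge, ?_, ?_⟩, ⟨?_, ?_⟩, ?_⟩
      · have := two_sub_le_of_norm (v := u - v) hu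
        rw [show u - v - u = -v by abel, norm_neg, hv] at this
        rw [show u - (v - u) = u - v + u by abel]; linarith
      · rw [sub_neg_eq_add, ← two_smul ℝ, norm_smul, hu]; norm_num
      · simp [hu]
      · have := two_sub_le_of_norm (v := v) hu
        rw [sub_neg_eq_add]; linarith
      · simp [hv])
  -- The factor `ω u v` makes the signs independent of the orientation of `u, v`.
  refine ⟨_, this.1, this.2, ω u v • ω u, ?_, ?_⟩
  · intro h0
    have := congrArg (fun f => f v) h0
    simp [hω] at this
  · simp only [List.mem_cons, List.not_mem_nil, or_false, Set.mem_ofPred_eq, forall_eq_or_imp,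
      forall_eq, LinearMap.smul_apply, smul_eq_mul, map_sub, map_neg, h.self]
    refine ⟨by simp, mul_self_nonneg _, by simpa using mul_self_nonneg _, by simp⟩

theorem exists_three_open (h : IsAreaForm ω) (hF : 1 < Module.rank ℝ F) :
    ∃ V : Set F, IsSeparated V ∧ V.encard = 3 ∧ ∃ f : F →ₗ[ℝ] ℝ, f ≠ 0 ∧ ∀ v ∈ V, 0 < f v := by
  obtain ⟨u, v, hu, hv, huv⟩ := exists_hexagon hF
  have hω := mul_self_pos.2 (h.hexagon_form_ne_zero hu hv huv)
  have := isSeparated_of_pairwise (l := [u, v, v - u])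
    (by simp [hu, hv, huv]) (by
      simp only [List.pairwise_cons, List.mem_cons, List.not_mem_nil, or_false, forall_eq_or_imp,
        forall_eq, IsEmpty.forall_iff, implies_true, List.Pairwise.nil, and_true]
      have huv' : ‖u - v‖ = 1 := by rwa [norm_sub_rev]
      refine ⟨⟨huv'.ge, ?_⟩, ?_⟩
      · have := two_sub_le_of_norm (v := u - v) hu
        rw [show u - v - u = -v by abel, norm_neg, hv] at this
        rw [show u - (v - u) = u - v + u by abel]; linarith
      · simp [hu])
  -- The functional is `ω u v` times pairing with `2 u - v`, a vector clockwise of all three when `ω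
  -- u v > 0`.
  have hpos : ∀ z ∈ {z | z ∈ [u, v, v - u]}, 0 < (ω u v • ((2 : ℝ) • ω u - ω v)) z := by
    simp only [List.mem_cons, List.not_mem_nil, or_false, Set.mem_ofPred_eq, forall_eq_or_imp,
      forall_eq, LinearMap.smul_apply, smul_eq_mul, map_sub, LinearMap.sub_apply, h.self,
      h.swap u v]
    refine ⟨?_, ?_, ?_⟩ <;> nlinarith
  refine ⟨_, this.1, this.2, _, fun h0 => ?_, hpos⟩
  have := hpos u (by simp)
  rw [h0] at this
  simp at this

end IsAreaForm

/-- The line through a long side misses the open unit ball. -/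
theorem one_le_norm_of_side {x w : F} {l : ℝ} (hl : 0 < l)
    (hside : ∀ t ∈ Set.Icc (0 : ℝ) l, ‖x + t • w‖ = 1) (r : ℝ) : 1 ≤ ‖x + r • w‖ :=
  one_le_norm_line (s := 0) (m := l / 2) (t := l) (by linarith) (by linarith)
    (hside 0 ⟨le_rfl, hl.le⟩).le (hside l ⟨hl.le, le_rfl⟩).le
    (hside _ ⟨by linarith, by linarith⟩).ge r

theorem IsAreaForm.exists_four_open {ω : F →ₗ[ℝ] F →ₗ[ℝ] ℝ} (h : IsAreaForm ω)
    (hlong : HasLongSide F) :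
    ∃ V : Set F, IsSeparated V ∧ V.encard = 4 ∧ ∃ f : F →ₗ[ℝ] ℝ, f ≠ 0 ∧ ∀ v ∈ V, 0 < f v := by
  obtain ⟨x, w, l, hl, hw, hside⟩ := hlong
  have hline := one_le_norm_of_side (by linarith) hside
  have hx : ‖x‖ = 1 := by simpa using hside 0 ⟨le_rfl, by linarith⟩
  have hω : ω x w ≠ 0 := by
    intro h0
    rcases h.eq_or_eq_neg hx hw h0 with rfl | rfl
    · have := hline (-1); simp at this; linarith
    · have := hline 1; simp at this; linarith
  have hω2 := mul_self_pos.2 hω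
  have two : ∀ r : ℝ, 1 ≤ ‖(2 : ℝ) • (x + r • w)‖ := fun r => by
    rw [norm_smul, Real.norm_ofNat]; linarith [hline r]
  -- Up to sign, each difference is one or two times a point of the line carrying the side, except
  -- the last, which is `w`.
  have := isSeparated_of_pairwise (l := [-x, w, x + l • w, x + (l - 1) • w])
    (by simp [hx, hw, hside l ⟨by linarith, le_rfl⟩,
      hside (l - 1) ⟨by linarith, by linarith⟩]) (by
      simp only [List.pairwise_cons, List.mem_cons, List.not_mem_nil, or_false, forall_eq_or_imp,
        forall_eq, IsEmpty.forall_iff, implies_true, List.Pairwise.nil, and_true]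
      refine ⟨⟨?_, ?_, ?_⟩, ⟨?_, ?_⟩, ?_⟩
      · rw [show -x - w = -(x + (1 : ℝ) • w) by module, norm_neg]; exact hline 1
      · rw [show -x - (x + l • w) = -((2 : ℝ) • (x + (l / 2) • w)) by module, norm_neg]
        exact two _
      · rw [show -x - (x + (l - 1) • w) = -((2 : ℝ) • (x + ((l - 1) / 2) • w)) by module,
          norm_neg]
        exact two _
      · rw [show w - (x + l • w) = -(x + (l - 1) • w) by module, norm_neg]; exact hline _
      · rw [show w - (x + (l - 1) • w) = -(x + (l - 2) • w) by module, norm_neg]; exact hline _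
      · rw [show x + l • w - (x + (l - 1) • w) = w by module, hw])
  -- Relative to `ω x w`, any tilt strictly between 0 and `l - 1` is positive on all four vectors;
  -- `l > 1` leaves room for one.
  have hpos : ∀ z ∈ {z | z ∈ [-x, w, x + l • w, x + (l - 1) • w]},
      0 < (ω x w • (ω x + ((l - 1) / 2) • ω w)) z := by
    simp only [List.mem_cons, List.not_mem_nil, or_false, Set.mem_ofPred_eq, forall_eq_or_imp,
      forall_eq, LinearMap.smul_apply, smul_eq_mul, map_add, map_smul, map_neg,
      LinearMap.add_apply, h.self, h.swap x w]
    have hk := mul_pos (sub_pos.2 hl) hω2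
    refine ⟨?_, ?_, ?_, ?_⟩ <;> nlinarith
  refine ⟨_, this.1, this.2, _, fun h0 => ?_, hpos⟩
  have := hpos w (by simp)
  rw [h0] at this
  simp at this

namespace IsAreaForm

variable {ω : F →ₗ[ℝ] F →ₗ[ℝ] ℝ}

theorem exists_eight (h : IsAreaForm ω) (hsq : HasSquareBall F) :
    ∃ V : Set F, IsSeparated V ∧ V.encard = 8 := by
  obtain ⟨x, y, hx, hy, hxy, hxy'⟩ := hsq
  obtain ⟨α, β, h1, h2, h3, h4, -, hn⟩ := h.exists_square_coord hx hy hxy hxy'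
  have := isSeparated_of_pairwise
    (l := [x, y, -x, -y, x + y, x - y, -x + y, -x - y]) (by simp [hn, h1, h2, h3, h4])
    (by simp [hn, h1, h2, h3, h4]; norm_num)
  exact ⟨_, this⟩

theorem exists_five_closed (h : IsAreaForm ω) (hsq : HasSquareBall F) :
    ∃ V : Set F, IsSeparated V ∧ V.encard = 5 ∧ ∃ f : F →ₗ[ℝ] ℝ, f ≠ 0 ∧ ∀ v ∈ V, 0 ≤ f v := by
  obtain ⟨x, y, hx, hy, hxy, hxy'⟩ := hsq
  obtain ⟨α, β, h1, h2, h3, h4, -, hn⟩ := h.exists_square_coord hx hy hxy hxy'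
  have := isSeparated_of_pairwise
    (l := [x, x + y, y, -x + y, -x]) (by simp [hn, h1, h2, h3, h4])
    (by simp [hn, h1, h2, h3, h4]; norm_num)
  refine ⟨_, this.1, this.2, β, fun h0 => ?_, by simp [h3, h4]⟩
  rw [h0] at h4; simp at h4

theorem exists_four_strict (h : IsAreaForm ω) (hsq : HasSquareBall F) :
    ∃ V : Set F, IsStrictlySeparated V ∧ V.encard = 4 := by
  obtain ⟨x, y, hx, hy, hxy, hxy'⟩ := hsq
  obtain ⟨α, β, h1, h2, h3, h4, -, hn⟩ := h.exists_square_coord hx hy hxy hxy'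
  have := isStrictlySeparated_of_pairwise
    (l := [x + y, x - y, -x + y, -x - y]) (by simp [hn, h1, h2, h3, h4])
    (by simp [hn, h1, h2, h3, h4]; norm_num)
  exact ⟨_, this⟩

end IsAreaForm

/-- The unit vector in the direction `q - ε p`. -/
noncomputable def rotateAway (p q : F) (ε : ℝ) : F := ‖q - ε • p‖⁻¹ • (q - ε • p)

theorem sub_smul_ne_zero {p q : F} (hp : ‖p‖ = 1) (hq : ‖q‖ = 1) {ε : ℝ}
    (hε : ε ∈ Set.Ioo (0 : ℝ) 1) : q - ε • p ≠ 0 := by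
  intro h0
  have := congrArg norm (sub_eq_zero.1 h0)
  rw [norm_smul, hp, hq, Real.norm_of_nonneg hε.1.le] at this
  linarith [hε.2]

theorem norm_rotateAway {p q : F} (hp : ‖p‖ = 1) (hq : ‖q‖ = 1) {ε : ℝ}
    (hε : ε ∈ Set.Ioo (0 : ℝ) 1) : ‖rotateAway p q ε‖ = 1 :=
  norm_smul_inv_norm (𝕜 := ℝ) (sub_smul_ne_zero hp hq hε)

theorem tendsto_rotateAway {p q : F} (hq : ‖q‖ = 1) :
    Tendsto (rotateAway p q) (𝓝[>] 0) (𝓝 q) := by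
  have : ContinuousAt (rotateAway p q) 0 := by
    unfold rotateAway
    refine ContinuousAt.smul (ContinuousAt.inv₀ (by fun_prop) ?_) (by fun_prop)
    simp [hq]
  have h0 : rotateAway p q 0 = q := by simp [rotateAway, hq]
  have h1 := this.tendsto
  rw [h0] at h1
  exact h1.mono_left nhdsWithin_le_nhds

/-- If the sphere has no long side, rotating a vector at distance `1` from `p` away from `p`
strictly increases the distance. -/
theorem one_lt_norm_rotateAway_sub (hlong : ¬ HasLongSide F) {p q : F} (hp : ‖p‖ = 1)
    (hq : ‖q‖ = 1) (hpq : ‖q - p‖ = 1) {ε : ℝ} (hε : ε ∈ Set.Ioo (0 : ℝ) 1) :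
    1 < ‖rotateAway p q ε - p‖ := by
  by_contra! hle
  have line : ∀ t : ℝ, q + t • -p = q - t • p := fun t => by module
  set r := ‖q - ε • p‖ with hr
  have hr0 : 0 < r := norm_pos_iff.2 (sub_smul_ne_zero hp hq hε)
  have hr1 : r ≤ 1 := by
    have := norm_line_three q (-p) hε.1.le hε.2.le
    rw [line, line, line, zero_smul, one_smul, sub_zero q, hq, hpq] at this
    linarith
  have hle' : ‖q - (ε + r) • p‖ ≤ r := by
    have e : q - (ε + r) • p = r • (rotateAway p q ε - p) := by
      rw [rotateAway, ← hr, smul_sub, smul_smul, mul_inv_cancel₀ hr0.ne']; module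
    rw [e, norm_smul, Real.norm_of_nonneg hr0.le]
    nlinarith
  -- The convex function `t ↦ ‖q - t p‖` is 1 at 0 and 1, `r` at `ε`, and at most `r` at `ε + r`.
  -- For `r < 1` this contradicts the triangle inequality or convexity; for `r = 1` it gives a side
  -- of length `1 + ε`.
  rcases hr1.lt_or_eq with h1 | h1
  · rcases le_or_gt (ε + r) 1 with h2 | h2
    · have := norm_sub_le (q - (ε + r) • p) ((1 - (ε + r)) • p)
      rw [show q - (ε + r) • p - (1 - (ε + r)) • p = q - p by module, hpq, norm_smul, hp,
        Real.norm_of_nonneg (by linarith)] at this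
      linarith [hε.1]
    · have := norm_line_three q (-p) hε.2.le h2.le
      rw [line, line, line, one_smul, hpq, ← hr] at this
      nlinarith [mul_le_mul_of_nonneg_left hle' (sub_nonneg.2 hε.2.le)]
  · refine hlong ⟨q, -p, 1 + ε, by linarith [hε.1], by rwa [norm_neg], fun t ht => ?_⟩
    refine norm_line_eq_one (m := 1) zero_lt_one (by linarith [hε.1]) ?_ ?_ ?_ ht
    · simp [hq]
    · rw [line, add_comm]; rw [h1] at hle'; exact hle'
    · rw [line, one_smul, hpq]

/-- Five consecutive hexagon vertices are opened up into the gap left by the sixth. Since the ball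
is not a parallelogram, nonadjacent vertices are already more than 1 apart. -/
theorem exists_five_strict_of_not_hasLongSide (hF : 1 < Module.rank ℝ F)
    (hlong : ¬ HasLongSide F) (hsq : ¬ HasSquareBall F) :
    ∃ V : Set F, IsStrictlySeparated V ∧ V.encard = 5 := by
  obtain ⟨u, v, hu, hv, huv⟩ := exists_hexagon hF
  have nsq : ∀ p q : F, ‖p‖ = 1 → ‖q‖ = 1 → ‖p - q‖ = 1 → 1 < ‖p + q‖ := by
    intro p q hp hq hpq
    by_contra! hle
    exact hsq ⟨p, q, hp, hq, hle, hpq.le⟩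
  have two : ∀ p : F, ‖p‖ = 1 → 1 < ‖p + p‖ := fun p hp => by
    rw [← two_smul ℝ, norm_smul, hp]; norm_num
  have huv' : ‖u - v‖ = 1 := by rwa [norm_sub_rev]
  have hu' : ‖-u‖ = 1 := by rwa [norm_neg]
  have hv' : ‖-v‖ = 1 := by rwa [norm_neg]
  have e1 : 1 < ‖u + v‖ := nsq u v hu hv huv'
  have e2 : 1 < ‖v + (v - u)‖ := nsq _ _ hv huv (by simpa using hu)
  have e3 : 1 < ‖u + (u - v)‖ := nsq _ _ hu huv' (by simpa using hv)
  have t1 := tendsto_rotateAway (p := v) hu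
  have t5 := tendsto_rotateAway (p := -u) hv'
  have t2 := tendsto_rotateAway (p := v - u) hv
  have t4 := tendsto_rotateAway (p := v - u) hu'
  have hIoo : ∀ᶠ ε : ℝ in 𝓝[>] 0, ε ∈ Set.Ioo (0 : ℝ) 1 := Ioo_mem_nhdsGT one_pos
  -- The outer vertices `u` and `-v` move first, away from their neighbours; `ε` is chosen later,
  -- after `δ`, to free `v` and `-u` from `v - u` without losing this gain.
  obtain ⟨δ, hδ, d13, d14, d15, d53, d52⟩ := (hIoo.and
    ((eventually_one_lt_norm_sub t1 (tendsto_const_nhds (x := v - u))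
      (by rwa [show u - (v - u) = u + (u - v) by abel])).and
    ((eventually_one_lt_norm_sub t1 (tendsto_const_nhds (x := -u))
      (by rw [sub_neg_eq_add]; exact two u hu)).and
    ((eventually_one_lt_norm_sub t1 t5 (by rwa [sub_neg_eq_add])).and
    ((eventually_one_lt_norm_sub t5 (tendsto_const_nhds (x := v - u))
      (by rwa [show -v - (v - u) = -(v + (v - u)) by abel, norm_neg])).and
    (eventually_one_lt_norm_sub t5 (tendsto_const_nhds (x := v))
      (by rw [← neg_add', norm_neg]; exact two v hv))))))).exists
  have d12 := one_lt_norm_rotateAway_sub hlong hv hu huv' hδ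
  have d54 := one_lt_norm_rotateAway_sub hlong hu' hv'
    (by rwa [show -v - -u = u - v by abel]) hδ
  have n1 := norm_rotateAway hv hu hδ
  have n5 := norm_rotateAway hu' hv' hδ
  set p1 := rotateAway v u δ
  set p5 := rotateAway (-u) (-v) δ
  obtain ⟨ε, hε, d12', d24, d25, d14', d45⟩ := (hIoo.and
    ((eventually_one_lt_norm_sub (tendsto_const_nhds (x := p1)) t2 d12).and
    ((eventually_one_lt_norm_sub t2 t4 (by rwa [sub_neg_eq_add, add_comm])).and
    ((eventually_one_lt_norm_sub t2 (tendsto_const_nhds (x := p5))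
      (by rwa [norm_sub_rev])).and
    ((eventually_one_lt_norm_sub (tendsto_const_nhds (x := p1)) t4 d14).and
    (eventually_one_lt_norm_sub t4 (tendsto_const_nhds (x := p5))
      (by rwa [norm_sub_rev]))))))).exists
  have d23 := one_lt_norm_rotateAway_sub hlong huv hv (by simpa using hu) hε
  have d43 := one_lt_norm_rotateAway_sub hlong huv hu'
    (by rwa [show -u - (v - u) = -v by abel]) hε
  have := isStrictlySeparated_of_pairwise
    (l := [p1, rotateAway (v - u) v ε, v - u, rotateAway (v - u) (-u) ε, p5])
    (by simp [n1, n5, huv, norm_rotateAway huv hv hε, norm_rotateAway huv hu' hε]) (by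
      simp only [List.pairwise_cons, List.mem_cons, List.not_mem_nil, or_false, forall_eq_or_imp,
        forall_eq, IsEmpty.forall_iff, implies_true, List.Pairwise.nil, and_true]
      exact ⟨⟨d12', d13, d14', d15⟩, ⟨d23, d24, d25⟩,
        ⟨by rwa [norm_sub_rev], by rwa [norm_sub_rev]⟩, d45⟩)
  exact ⟨_, this⟩

theorem exists_maximal_side {x w : F} {l : ℝ} (hl : 0 < l) (hw : ‖w‖ = 1)
    (hside : ∀ t ∈ Set.Icc (0 : ℝ) l, ‖x + t • w‖ = 1) :
    ∃ a b : ℝ, l ≤ b - a ∧ (∀ t ∈ Set.Icc a b, ‖x + t • w‖ = 1) ∧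
      ∀ t ∉ Set.Icc a b, 1 < ‖x + t • w‖ := by
  have hx : ‖x‖ = 1 := by simpa using hside 0 ⟨le_rfl, hl.le⟩
  have hcomp : IsCompact {t : ℝ | ‖x + t • w‖ ≤ 1} := by
    refine Metric.isCompact_of_isClosed_isBounded (isClosed_le (by fun_prop) continuous_const) ?_
    refine (Metric.isBounded_iff_subset_closedBall 0).2 ⟨2, fun t ht => ?_⟩
    have h1 := norm_sub_le (x + t • w) x
    rw [add_sub_cancel_left, norm_smul, hw, hx, mul_one] at h1
    rw [mem_closedBall_zero_iff]
    linarith [show ‖x + t • w‖ ≤ 1 from ht]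
  have h0 : (0 : ℝ) ∈ {t : ℝ | ‖x + t • w‖ ≤ 1} := (hside 0 ⟨le_rfl, hl.le⟩).le
  have hl' : l ∈ {t : ℝ | ‖x + t • w‖ ≤ 1} := (hside l ⟨hl.le, le_rfl⟩).le
  obtain ⟨a, ha, ha'⟩ := hcomp.exists_isLeast ⟨0, h0⟩
  obtain ⟨b, hb, hb'⟩ := hcomp.exists_isGreatest ⟨0, h0⟩
  have h1 := ha' h0
  have h2 := hb' hl'
  refine ⟨a, b, by linarith, fun t ht => ?_, fun t ht => ?_⟩
  · exact norm_line_eq_one (m := l / 2) (by linarith) (by linarith) ha hb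
      (one_le_norm_of_side hl hside _) ht
  · by_contra! hle
    exact ht ⟨ha' hle, hb' hle⟩

/-- The five vectors are the ends of a maximal side, the directions `±w` rotated slightly away from
its midpoint, and the negated midpoint. -/
theorem exists_five_strict_of_hasLongSide (hlong : HasLongSide F) (hsq : ¬ HasSquareBall F) :
    ∃ V : Set F, IsStrictlySeparated V ∧ V.encard = 5 := by
  obtain ⟨x, w, l, hl, hw, hside⟩ := hlong
  have hline := one_le_norm_of_side (by linarith) hside
  obtain ⟨a, b, hab, hin, hout⟩ := exists_maximal_side (by linarith) hw hside
  have hw' : ‖-w‖ = 1 := by rwa [norm_neg]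
  set m := (a + b) / 2 with hm
  have nM : ‖x + m • w‖ = 1 := hin m ⟨by linarith, by linarith⟩
  -- A side of length 2 or more would make its midpoint and `w` span a parallelogram ball. The bound
  -- puts the points at distance 1 from the midpoint off the side, hence outside the ball.
  have hlt : b - a < 2 := by
    by_contra! hle
    refine hsq ⟨x + m • w, w, nM, hw, ?_, ?_⟩
    · rw [show x + m • w + w = x + (m + 1) • w by module]
      exact (hin _ ⟨by linarith, by linarith⟩).le
    · rw [show x + m • w - w = x + (m - 1) • w by module]
      exact (hin _ ⟨by linarith, by linarith⟩).le
  have hp : 1 < ‖w - -(x + m • w)‖ := by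
    rw [show w - -(x + m • w) = x + (m + 1) • w by module]
    exact hout _ fun hmem => by linarith [hmem.2]
  have hq : 1 < ‖-w - -(x + m • w)‖ := by
    rw [show -w - -(x + m • w) = x + (m - 1) • w by module]
    exact hout _ fun hmem => by linarith [hmem.1]
  have tC := tendsto_rotateAway (p := x + m • w) hw
  have tE := tendsto_rotateAway (p := x + m • w) hw'
  have hIoo : ∀ᶠ ε : ℝ in 𝓝[>] 0, ε ∈ Set.Ioo (0 : ℝ) 1 := Ioo_mem_nhdsGT one_pos
  obtain ⟨ε, hε, dCD, dED, dCE⟩ := (hIoo.and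
    ((eventually_one_lt_norm_sub tC (tendsto_const_nhds (x := -(x + m • w))) hp).and
    ((eventually_one_lt_norm_sub tE (tendsto_const_nhds (x := -(x + m • w))) hq).and
    (eventually_one_lt_norm_sub tC tE (by
      rw [sub_neg_eq_add, ← two_smul ℝ, norm_smul, hw]; norm_num))))).exists
  have far : ∀ (t : ℝ) (q : F), ‖q‖ = 1 → (∃ s : ℝ, q = s • w) →
      1 < ‖x + t • w - rotateAway (x + m • w) q ε‖ := by
    rintro t q hq ⟨s, rfl⟩
    have hr : 0 < ‖s • w - ε • (x + m • w)‖ := norm_pos_iff.2 (sub_smul_ne_zero nM hq hε)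
    have hc : 0 < ‖s • w - ε • (x + m • w)‖⁻¹ * ε := mul_pos (inv_pos.2 hr) hε.1
    rw [rotateAway]
    set c := ‖s • w - ε • (x + m • w)‖⁻¹
    -- Rotation lowers `±w` by `c ε`, so the difference is `1 + c ε` times a point of the line of
    -- the side, which misses the open ball.
    have e : x + t • w - c • (s • w - ε • (x + m • w)) =
        (1 + c * ε) • (x + ((1 + c * ε)⁻¹ * (t - c * s + c * ε * m)) • w) := by
      have hc' : 1 + c * ε ≠ 0 := by positivity
      rw [smul_add (1 + c * ε), smul_smul, mul_inv_cancel_left₀ hc']; module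
    rw [e, norm_smul, Real.norm_of_nonneg (by positivity)]
    have := hline ((1 + c * ε)⁻¹ * (t - c * s + c * ε * m))
    nlinarith
  have two : ∀ t : ℝ, 1 < ‖x + t • w - -(x + m • w)‖ := fun t => by
    rw [show x + t • w - -(x + m • w) = (2 : ℝ) • (x + ((t + m) / 2) • w) by module, norm_smul,
      Real.norm_ofNat]
    linarith [hline ((t + m) / 2)]
  have := isStrictlySeparated_of_pairwise (l := [x + a • w, x + b • w,
      rotateAway (x + m • w) w ε, rotateAway (x + m • w) (-w) ε, -(x + m • w)])
    (by
      simp only [List.mem_cons, List.not_mem_nil, or_false, forall_eq_or_imp, forall_eq]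
      exact ⟨hin a ⟨le_rfl, by linarith⟩, hin b ⟨by linarith, le_rfl⟩,
        norm_rotateAway nM hw hε, norm_rotateAway nM hw' hε, by rwa [norm_neg]⟩) (by
      simp only [List.pairwise_cons, List.mem_cons, List.not_mem_nil, or_false, forall_eq_or_imp,
        forall_eq, IsEmpty.forall_iff, implies_true, List.Pairwise.nil, and_true]
      refine ⟨⟨?_, far _ _ hw ⟨1, by simp⟩, far _ _ hw' ⟨-1, by simp⟩, two _⟩,
        ⟨far _ _ hw ⟨1, by simp⟩, far _ _ hw' ⟨-1, by simp⟩, two _⟩, ⟨dCE, dCD⟩, dED⟩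
      rw [show x + a • w - (x + b • w) = -((b - a) • w) by module, norm_neg, norm_smul, hw,
        Real.norm_of_nonneg (by linarith)]
      linarith)
  exact ⟨_, this⟩

end LowerBounds

/-! ### Translates of a convex body through the gauge of `C - C`. -/

section Gauge

universe u

theorem Seminorm.exists_normedSpace {E : Type u} [AddCommGroup E] [Module ℝ E]
    (p : Seminorm ℝ E) (hp : ∀ x, p x = 0 → x = 0) :
    ∃ (F : Type u) (_ : NormedAddCommGroup F) (_ : NormedSpace ℝ F) (L : E ≃ₗ[ℝ] F),
      ∀ x, ‖L x‖ = p x := by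
  let _ : Norm E := ⟨p⟩
  have core : NormedSpace.Core ℝ E :=
    { norm_nonneg := fun x => apply_nonneg p x
      norm_smul := fun c x => map_smul_eq_mul p c x
      norm_triangle := fun x y => map_add_le_add p x y
      norm_eq_zero_iff := fun x => ⟨hp x, fun h => by subst h; exact map_zero p⟩ }
  let _ : NormedAddCommGroup E := NormedAddCommGroup.ofCore core
  let _ : NormedSpace ℝ E := NormedSpace.ofCore core
  exact ⟨E, inferInstance, inferInstance, LinearEquiv.refl ℝ E, fun _ => rfl⟩

theorem sub_self_mem_nhds {E : Type*} [NormedAddCommGroup E] {C : Set E}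
    (hint : (interior C).Nonempty) : C - C ∈ nhds (0 : E) := by
  obtain ⟨o, ho⟩ := hint
  refine Filter.mem_of_superset ((isOpen_interior (s := C)).sub_right (s := interior C)
    |>.mem_nhds ⟨o, ho, o, ho, sub_self o⟩) (Set.sub_subset_sub interior_subset interior_subset)

variable {E : Type u} [NormedAddCommGroup E] [NormedSpace ℝ E] {C : Set E}

/-- An interior point is `t (c - c')` with `t < 1`; shrinking `c` and `c'` by `t` towards one
interior point `o` keeps this difference and moves both into the interior. -/
theorem Convex.interior_sub_self (hconv : Convex ℝ C) (hint : (interior C).Nonempty)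
    (hK : C - C ∈ nhds 0) :
    interior (C - C) = interior C - interior C := by
  refine Set.Subset.antisymm (fun v hv => ?_) (interior_maximal
    (Set.sub_subset_sub interior_subset interior_subset) isOpen_interior.sub_right)
  obtain ⟨o, ho⟩ := hint
  have hg : gauge (C - C) v < 1 := (gauge_lt_one_iff_mem_interior (hconv.sub hconv) hK).2 hv
  obtain ⟨t, ht0, ht1, k, ⟨c, hc, c', hc', rfl⟩, rfl⟩ :=
    exists_lt_of_gauge_lt (absorbent_nhds_zero hK) hg
  have aux : ∀ c ∈ C, t • c + (1 - t) • o ∈ interior C := fun c hc =>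
    hconv.combo_self_interior_mem_interior hc ho ht0.le (by linarith) (by ring)
  refine ⟨_, aux c hc, _, aux c' hc', ?_⟩
  simp only
  module

/-- The linear isomorphism `L` carries the gauge of `C - C` to the norm. -/
structure IsGaugeModel {F : Type*} [NormedAddCommGroup F] [NormedSpace ℝ F] (C : Set E)
    (L : E ≃ₗ[ℝ] F) : Prop where
  norm_eq : ∀ x, ‖L x‖ = gauge (C - C) x
  norm_le_one : ∀ x, ‖L x‖ ≤ 1 ↔ x ∈ C - C
  norm_lt_one : ∀ x, ‖L x‖ < 1 ↔ x ∈ interior C - interior C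

theorem exists_isGaugeModel (hconv : Convex ℝ C) (hcomp : IsCompact C)
    (hint : (interior C).Nonempty) :
    ∃ (F : Type u) (_ : NormedAddCommGroup F) (_ : NormedSpace ℝ F) (L : E ≃ₗ[ℝ] F),
      IsGaugeModel C L := by
  have hK := sub_self_mem_nhds hint
  have hKc : IsCompact (C - C) := by rw [sub_eq_add_neg]; exact hcomp.add hcomp.neg
  have hbal : Balanced ℝ (C - C) := (balanced_iff_neg_mem (hconv.sub hconv)).2 (by
    rintro x ⟨c, hc, c', hc', rfl⟩
    exact ⟨c', hc', c, hc, (neg_sub c c').symm⟩)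
  obtain ⟨F, i1, i2, L, hL⟩ :=
    (gaugeSeminorm hbal (hconv.sub hconv) (absorbent_nhds_zero hK)).exists_normedSpace
      fun x hx => (gauge_eq_zero (absorbent_nhds_zero hK) (hKc.isVonNBounded ℝ)).1 hx
  have hL' : ∀ x, ‖L x‖ = gauge (C - C) x := hL
  refine ⟨F, i1, i2, L, hL', fun x => ?_, fun x => ?_⟩
  · rw [hL', gauge_le_one_iff_mem_closure (hconv.sub hconv) hK, hKc.isClosed.closure_eq]
  · rw [hL', gauge_lt_one_iff_mem_interior (hconv.sub hconv) hK,
      hconv.interior_sub_self hint hK]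

theorem disjoint_vadd_vadd_iff {E : Type*} [AddCommGroup E] {A : Set E} {v w : E} :
    Disjoint (v +ᵥ A) (w +ᵥ A) ↔ w - v ∉ A - A := by
  rw [Set.disjoint_left, ← not_iff_not]
  push Not
  constructor
  · rintro ⟨x, ⟨a, ha, rfl⟩, ⟨b, hb, hab⟩⟩
    refine ⟨a, ha, b, hb, ?_⟩
    simp only [vadd_eq_add] at hab ⊢
    rw [sub_eq_sub_iff_add_eq_add, add_comm a, ← hab, add_comm]
  · rintro ⟨a, ha, b, hb, hab⟩
    refine ⟨v + a, ⟨a, ha, rfl⟩, ⟨b, hb, ?_⟩⟩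
    simp only [vadd_eq_add] at hab ⊢
    rw [sub_eq_sub_iff_add_eq_add] at hab
    rw [← hab, add_comm]

namespace IsGaugeModel

variable {F : Type*} [NormedAddCommGroup F] [NormedSpace ℝ F] {L : E ≃ₗ[ℝ] F}

theorem disjoint_iff (h : IsGaugeModel C L) (v w : E) :
    Disjoint (v +ᵥ C) (w +ᵥ C) ↔ 1 < ‖L v - L w‖ := by
  rw [disjoint_vadd_vadd_iff, ← h.norm_le_one, not_le, map_sub, norm_sub_rev]

theorem disjoint_interior_iff (h : IsGaugeModel C L) (v w : E) :
    Disjoint (interior (v +ᵥ C)) (interior (w +ᵥ C)) ↔ 1 ≤ ‖L v - L w‖ := by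
  rw [interior_vadd, interior_vadd, disjoint_vadd_vadd_iff, ← h.norm_lt_one, not_lt, map_sub,
    norm_sub_rev]

theorem touches_iff (h : IsGaugeModel C L) (v : E) : Touches (v +ᵥ C) C ↔ ‖L v‖ = 1 := by
  have h1 := h.disjoint_iff v 0
  have h2 := h.disjoint_interior_iff v 0
  rw [zero_vadd, map_zero, sub_zero] at h1 h2
  rw [Touches, ← Set.not_disjoint_iff_nonempty_inter, h1, h2, not_lt]
  exact ⟨fun h => le_antisymm h.1 h.2, fun h => ⟨h.le, h.ge⟩⟩

theorem isHadwigerFamily_iff (h : IsGaugeModel C L) (V : Set E) :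
    IsHadwigerFamily C V ↔ IsSeparated (L '' V) := by
  rw [IsHadwigerFamily, IsSeparated, Set.forall_mem_image,
    L.injective.injOn.pairwise_image]
  simp only [h.touches_iff, h.disjoint_interior_iff]

theorem isStrictHadwigerFamily_iff (h : IsGaugeModel C L) (V : Set E) :
    IsStrictHadwigerFamily C V ↔ IsStrictlySeparated (L '' V) := by
  rw [IsStrictHadwigerFamily, IsStrictlySeparated, Set.forall_mem_image,
    L.injective.injOn.pairwise_image]
  simp only [h.touches_iff, h.disjoint_iff]

end IsGaugeModel

theorem inClosedHalfSpace_iff [FiniteDimensional ℝ E] {F : Type*} [NormedAddCommGroup F]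
    [NormedSpace ℝ F] (L : E ≃ₗ[ℝ] F) (V : Set E) :
    InClosedHalfSpace V ↔ ∃ f : F →ₗ[ℝ] ℝ, f ≠ 0 ∧ ∀ v ∈ L '' V, 0 ≤ f v := by
  constructor
  · rintro ⟨f, hf, hV⟩
    refine ⟨f.toLinearMap ∘ₗ L.symm.toLinearMap, fun h0 => hf ?_, by simpa using hV⟩
    ext x
    simpa using congrArg (fun g => g (L x)) h0
  · rintro ⟨f, hf, hV⟩
    refine ⟨LinearMap.toContinuousLinearMap (f ∘ₗ L.toLinearMap), fun h0 => hf ?_,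
      by simpa using hV⟩
    ext x
    simpa using congrArg (fun g => g (L.symm x)) h0

theorem inOpenHalfSpace_iff [FiniteDimensional ℝ E] {F : Type*} [NormedAddCommGroup F]
    [NormedSpace ℝ F] (L : E ≃ₗ[ℝ] F) (V : Set E) :
    InOpenHalfSpace V ↔ ∃ f : F →ₗ[ℝ] ℝ, f ≠ 0 ∧ ∀ v ∈ L '' V, 0 < f v := by
  constructor
  · rintro ⟨f, hf, hV⟩
    refine ⟨f.toLinearMap ∘ₗ L.symm.toLinearMap, fun h0 => hf ?_, by simpa using hV⟩
    ext x
    simpa using congrArg (fun g => g (L x)) h0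
  · rintro ⟨f, hf, hV⟩
    refine ⟨LinearMap.toContinuousLinearMap (f ∘ₗ L.toLinearMap), fun h0 => hf ?_,
      by simpa using hV⟩
    ext x
    simpa using congrArg (fun g => g (L.symm x)) h0

/-- Since `Q` passes to subsets, excluding cardinality exactly `n + 1` excludes every larger and
every infinite family. -/
theorem sSup_encard_eq {α β : Type*} (L : α ≃ β) {P : Set α → Prop} {Q : Set β → Prop}
    (hPQ : ∀ V, P V ↔ Q (L '' V)) {n : ℕ} (hub : ∀ s : Finset β, Q s → s.card ≠ n + 1)
    (hmono : ∀ W W' : Set β, W' ⊆ W → Q W → Q W') (hex : ∃ W, Q W ∧ W.encard = n) :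
    sSup (Set.encard '' {V : Set α | P V}) = n := by
  apply le_antisymm
  · refine sSup_le ?_
    rintro _ ⟨V, hV, rfl⟩
    by_contra! hlt
    rw [← L.injective.encard_image] at hlt
    obtain ⟨W, hW, hWn⟩ := Set.exists_subset_encard_eq (Order.add_one_le_of_lt hlt)
    have hfin : W.Finite := Set.finite_of_encard_eq_coe (k := n + 1) (by exact_mod_cast hWn)
    lift W to Finset β using hfin
    refine hub W (hmono _ _ hW ((hPQ V).1 hV)) ?_
    rw [Set.encard_coe_eq_coe_finsetCard] at hWn
    exact_mod_cast hWn
  · obtain ⟨W, hW, hWn⟩ := hex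
    refine le_sSup ⟨L.symm '' W, (hPQ _).2 (by rwa [L.image_symm_image]), ?_⟩
    rw [L.symm.injective.encard_image, hWn]

end Gauge

/-! ### The segment length `λ` and parallelograms in terms of the norm. -/

section Model

variable {E : Type*} [NormedAddCommGroup E] [NormedSpace ℝ E] {C : Set E}
  {F : Type*} [NormedAddCommGroup F] [NormedSpace ℝ F] {L : E ≃ₗ[ℝ] F}

namespace IsGaugeModel

theorem gauge_centralSymmetral (h : IsGaugeModel C L) (x : E) :
    gauge (centralSymmetral C) x = 2 * ‖L x‖ := by
  rw [centralSymmetral, gauge_smul_left_of_nonneg (by norm_num), inv_inv, Pi.smul_apply,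
    smul_eq_mul, h.norm_eq]

theorem mem_frontier_centralSymmetral (h : IsGaugeModel C L) (hconv : Convex ℝ C)
    (hint : (interior C).Nonempty) (x : E) :
    x ∈ frontier (centralSymmetral C) ↔ 2 * ‖L x‖ = 1 := by
  rw [← h.gauge_centralSymmetral, gauge_eq_one_iff_mem_frontier]
  · exact (hconv.sub hconv).smul _
  · exact (set_smul_mem_nhds_zero_iff (by norm_num)).2 (sub_self_mem_nhds hint)

/-- The gauge of `½(C - C)` is twice the model norm, so doubling carries its boundary to the unit
sphere and its lengths to model lengths. -/
theorem one_lt_maxBoundarySegment_iff (h : IsGaugeModel C L) (hconv : Convex ℝ C)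
    (hint : (interior C).Nonempty) :
    1 < maxBoundarySegment (centralSymmetral C) ↔ HasLongSide F := by
  have two : ∀ z : F, ‖(2 : ℝ) • z‖ = 2 * ‖z‖ := fun z => by rw [norm_smul, Real.norm_ofNat]
  constructor
  · intro hlt
    have hne : {l : ℝ | ∃ x y : E, segment ℝ x y ⊆ frontier (centralSymmetral C) ∧
        l = gauge (centralSymmetral C) (y - x)}.Nonempty := by
      -- The real supremum of the empty set is 0, which is not above 1.
      by_contra hemp
      rw [Set.not_nonempty_iff_eq_empty] at hemp
      rw [maxBoundarySegment, hemp, Real.sSup_empty] at hlt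
      linarith
    obtain ⟨l, ⟨x, y, hseg, hl⟩, hl1⟩ := exists_lt_of_lt_csSup hne hlt
    rw [h.gauge_centralSymmetral] at hl
    have hl0 : 0 < l := by linarith
    refine ⟨(2 : ℝ) • L x, l⁻¹ • (2 : ℝ) • L (y - x), l, hl1, ?_, fun t ht => ?_⟩
    · rw [norm_smul, two, ← hl, norm_inv, Real.norm_of_nonneg hl0.le, inv_mul_cancel₀ hl0.ne']
    · have hmem : x + (t / l) • (y - x) ∈ segment ℝ x y := by
        rw [segment_eq_image']
        exact ⟨t / l, ⟨div_nonneg ht.1 hl0.le, (div_le_one hl0).2 ht.2⟩, rfl⟩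
      have := (h.mem_frontier_centralSymmetral hconv hint _).1 (hseg hmem)
      rw [← two] at this
      rw [← this, map_add, map_smul, div_eq_mul_inv]
      congr 1
      module
  · rintro ⟨x, w, l, hl, hw, hside⟩
    refine hl.trans_le (le_csSup ⟨2, ?_⟩ ⟨L.symm ((2⁻¹ : ℝ) • x),
      L.symm ((2⁻¹ : ℝ) • (x + l • w)), ?_, ?_⟩)
    · rintro _ ⟨x, y, hseg, rfl⟩
      have hx := (h.mem_frontier_centralSymmetral hconv hint _).1 (hseg (left_mem_segment ℝ x y))
      have hy := (h.mem_frontier_centralSymmetral hconv hint _).1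
        (hseg (right_mem_segment ℝ x y))
      have := norm_sub_le (L y) (L x)
      rw [h.gauge_centralSymmetral, map_sub]
      linarith
    · rw [segment_eq_image']
      rintro _ ⟨θ, hθ, rfl⟩
      rw [h.mem_frontier_centralSymmetral hconv hint, ← two]
      have := hside (θ * l) ⟨mul_nonneg hθ.1 (by linarith), by nlinarith [hθ.2]⟩
      rw [← this]
      simp only [map_add, map_smul, map_sub, LinearEquiv.apply_symm_apply]
      congr 1
      module
    · rw [h.gauge_centralSymmetral, ← two]
      have : (2 : ℝ) • L (L.symm ((2⁻¹ : ℝ) • (x + l • w)) - L.symm ((2⁻¹ : ℝ) • x)) =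
          l • w := by
        simp only [map_sub, LinearEquiv.apply_symm_apply]
        module
      rw [this, norm_smul, hw, Real.norm_of_nonneg (by linarith), mul_one]

/-- If `‖L w0‖ < 1`, normalising `w0` would give a point of `C - C` with first coordinate greater
than 1. -/
theorem norm_eq_one_of_parallelogram (h : IsGaugeModel C L) {w0 w1 : E}
    (hli : LinearIndependent ℝ ![w0, w1])
    (hK : ∀ z, z ∈ C - C → ∃ α β : ℝ, |α| ≤ 1 ∧ z = α • w0 + β • w1) (h0 : w0 ∈ C - C) :
    ‖L w0‖ = 1 := by
  refine le_antisymm ((h.norm_le_one _).2 h0) ?_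
  by_contra! hlt
  have hw0 : w0 ≠ 0 := hli.ne_zero 0
  have hpos : 0 < ‖L w0‖ := norm_pos_iff.2 (by simpa using hw0)
  obtain ⟨α, β, hα, e⟩ := hK (‖L w0‖⁻¹ • w0) ((h.norm_le_one _).1 (by
    rw [map_smul]; exact (norm_smul_inv_norm (𝕜 := ℝ) (norm_pos_iff.1 hpos)).le))
  have := LinearIndependent.pair_iff.1 hli (‖L w0‖⁻¹ - α) (-β) (by
    rw [sub_smul, e]; module)
  have h1 := one_lt_inv_iff₀.2 ⟨hpos, hlt⟩
  have h2 := (abs_le.1 hα).2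
  linarith [this.1]

theorem hasSquareBall_of_isParallelogram (h : IsGaugeModel C L) (hC : IsParallelogram C) :
    HasSquareBall F := by
  obtain ⟨p, w, hli, rfl⟩ := hC
  have hK : ∀ z, z ∈ (p +ᵥ parallelepiped w) - (p +ᵥ parallelepiped w) ↔
      ∃ α β : ℝ, |α| ≤ 1 ∧ |β| ≤ 1 ∧ z = α • w 0 + β • w 1 := by
    intro z
    have hmem : ∀ c, c ∈ p +ᵥ parallelepiped w ↔ ∃ s t : ℝ, (0 ≤ s ∧ s ≤ 1) ∧ (0 ≤ t ∧ t ≤ 1) ∧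
        c = p + (s • w 0 + t • w 1) := by
      intro c
      simp only [Set.mem_vadd_set, mem_parallelepiped_iff, Fin.sum_univ_two, vadd_eq_add]
      constructor
      · rintro ⟨_, ⟨t, ht, rfl⟩, rfl⟩
        exact ⟨t 0, t 1, ⟨ht.1 0, ht.2 0⟩, ⟨ht.1 1, ht.2 1⟩, rfl⟩
      · rintro ⟨s, t, hs, ht, rfl⟩
        refine ⟨_, ⟨![s, t], ⟨fun i => ?_, fun i => ?_⟩, rfl⟩, rfl⟩ <;> fin_cases i <;>
          simp [hs, ht]
    constructor
    · rintro ⟨a, ha, b, hb, rfl⟩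
      obtain ⟨s, t, hs, ht, rfl⟩ := (hmem a).1 ha
      obtain ⟨s', t', hs', ht', rfl⟩ := (hmem b).1 hb
      refine ⟨s - s', t - t', abs_le.2 ⟨by linarith, by linarith⟩,
        abs_le.2 ⟨by linarith, by linarith⟩, ?_⟩
      simp only
      module
    · rintro ⟨α, β, hα, hβ, rfl⟩
      rw [abs_le] at hα hβ
      -- A pair of points symmetric about the centre of the parallelogram with the prescribed
      -- difference.
      refine ⟨_, (hmem _).2 ⟨(1 + α) / 2, (1 + β) / 2, ⟨by linarith, by linarith⟩,
        ⟨by linarith, by linarith⟩, rfl⟩, _, (hmem _).2 ⟨(1 - α) / 2, (1 - β) / 2,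
        ⟨by linarith, by linarith⟩, ⟨by linarith, by linarith⟩, rfl⟩, ?_⟩
      simp only
      module
  have hli' : LinearIndependent ℝ ![w 0, w 1] := by
    convert hli using 1
    ext i; fin_cases i <;> rfl
  refine ⟨L (w 0), L (w 1), ?_, ?_, ?_, ?_⟩
  · exact h.norm_eq_one_of_parallelogram hli'
      (fun z hz => by obtain ⟨α, β, h1, -, e⟩ := (hK z).1 hz; exact ⟨α, β, h1, e⟩)
      ((hK _).2 ⟨1, 0, by simp, by simp, by simp⟩)
  · exact h.norm_eq_one_of_parallelogram (LinearIndependent.pair_symm_iff.1 hli')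
      (fun z hz => by
        obtain ⟨α, β, -, h1, e⟩ := (hK z).1 hz; exact ⟨β, α, h1, by rw [e, add_comm]⟩)
      ((hK _).2 ⟨0, 1, by simp, by simp, by simp⟩)
  · rw [← map_add, h.norm_le_one]
    exact (hK _).2 ⟨1, 1, by simp, by simp, by simp⟩
  · rw [← map_sub, h.norm_le_one]
    exact (hK _).2 ⟨1, -1, by simp, by simp, by simp [sub_eq_add_neg]⟩

/-- In max-norm coordinates `C` has width at most 1 in both directions. Writing `X + Y` and `X - Y`
as differences of points of `C` attains both widths, which pins four points of `C` to the corners of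
a unit box; convexity fills the box. -/
theorem isParallelogram_of_hasSquareBall (h : IsGaugeModel C L) (hconv : Convex ℝ C)
    {ω : F →ₗ[ℝ] F →ₗ[ℝ] ℝ} (hω : IsAreaForm ω) (hsq : HasSquareBall F) :
    IsParallelogram C := by
  obtain ⟨x, y, hx, hy, hxy, hxy'⟩ := hsq
  obtain ⟨α, β, hαx, hαy, hβx, hβy, hz, hn⟩ := hω.exists_square_coord hx hy hxy hxy'
  set X := L.symm x with hX
  set Y := L.symm y with hY
  have hLX : L X = x := L.apply_symm_apply x
  have hLY : L Y = y := L.apply_symm_apply y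
  have hz' : ∀ z, z = α (L z) • X + β (L z) • Y := fun z => L.injective (by
    rw [map_add, map_smul, map_smul, hLX, hLY]; exact hz _)
  have ext : ∀ a b : E, α (L a) = α (L b) → β (L a) = β (L b) → a = b := fun a b h1 h2 => by
    rw [hz' a, hz' b, h1, h2]
  have width : ∀ a ∈ C, ∀ b ∈ C, α (L a) - α (L b) ≤ 1 ∧ β (L a) - β (L b) ≤ 1 := by
    intro a ha b hb
    have h1 := (h.norm_le_one (a - b)).2 ⟨a, ha, b, hb, rfl⟩
    rw [hn, map_sub, map_sub, map_sub, max_le_iff] at h1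
    exact ⟨(abs_le.1 h1.1).2, (abs_le.1 h1.2).2⟩
  obtain ⟨c1, hc1, c2, hc2, e12⟩ : X + Y ∈ C - C := (h.norm_le_one _).1 (by
    rwa [map_add, hLX, hLY])
  obtain ⟨c3, hc3, c4, hc4, e34⟩ : X - Y ∈ C - C := (h.norm_le_one _).1 (by
    rwa [map_sub, hLX, hLY])
  have a12 : α (L c1) - α (L c2) = 1 := by
    rw [← map_sub, ← map_sub]
    simp only at e12
    rw [e12, map_add, hLX, hLY, map_add, hαx, hαy, add_zero]
  have b12 : β (L c1) - β (L c2) = 1 := by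
    rw [← map_sub, ← map_sub]
    simp only at e12
    rw [e12, map_add, hLX, hLY, map_add, hβx, hβy, zero_add]
  have a34 : α (L c3) - α (L c4) = 1 := by
    rw [← map_sub, ← map_sub]
    simp only at e34
    rw [e34, map_sub, hLX, hLY, map_sub, hαx, hαy, sub_zero]
  have b34 : β (L c4) - β (L c3) = 1 := by
    have : β (L c3) - β (L c4) = -1 := by
      rw [← map_sub, ← map_sub]; simp only at e34
      rw [e34, map_sub, hLX, hLY, map_sub, hβx, hβy, zero_sub]
    linarith
  have w14 := width _ hc1 _ hc4
  have w32 := width _ hc3 _ hc2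
  have w13 := width _ hc1 _ hc3
  have w42 := width _ hc4 _ hc2
  have e3 : c3 = c2 + X := ext _ _
    (by rw [map_add, map_add, hLX, hαx]; linarith)
    (by rw [map_add, map_add, hLX, hβx]; linarith)
  have e4 : c4 = c2 + Y := ext _ _
    (by rw [map_add, map_add, hLY, hαy]; linarith)
    (by rw [map_add, map_add, hLY, hβy]; linarith)
  have e1 : c1 = c2 + X + Y := ext _ _
    (by rw [map_add, map_add, map_add, map_add, hLX, hLY, hαx, hαy]; linarith)
    (by rw [map_add, map_add, map_add, map_add, hLX, hLY, hβx, hβy]; linarith)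
  refine ⟨c2, ![X, Y], ?_, ?_⟩
  · rw [LinearIndependent.pair_iff]
    intro s t hst
    have := congrArg L hst
    rw [map_add, map_smul, map_smul, hLX, hLY, map_zero] at this
    have h1 := congrArg α this
    have h2 := congrArg β this
    simp only [map_add, map_smul, map_zero, hαx, hαy, hβx, hβy, smul_eq_mul] at h1 h2
    exact ⟨by linarith, by linarith⟩
  · ext c
    simp only [Set.mem_vadd_set, mem_parallelepiped_iff, Fin.sum_univ_two, vadd_eq_add]
    constructor
    · intro hc
      have w1 := width _ hc1 _ hc
      have w2 := width _ hc _ hc2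
      refine ⟨_, ⟨![α (L (c - c2)), β (L (c - c2))], ⟨fun i => ?_, fun i => ?_⟩, rfl⟩, ?_⟩
      · fin_cases i <;> simp <;> linarith
      · fin_cases i <;> simp <;> linarith
      · have := hz' (c - c2)
        simp only [Matrix.cons_val_zero, Matrix.cons_val_one]
        rw [← this]; abel
    · rintro ⟨_, ⟨t, ht, rfl⟩, rfl⟩
      simp only [Matrix.cons_val_zero, Matrix.cons_val_one]
      have hs0 : 0 ≤ t 0 := ht.1 0
      have hs1 : t 0 ≤ 1 := ht.2 0
      have ht0 : 0 ≤ t 1 := ht.1 1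
      have ht1 : t 1 ≤ 1 := ht.2 1
      rw [e3] at hc3
      rw [e4] at hc4
      rw [e1] at hc1
      have m1 := hconv hc2 hc3 (sub_nonneg.2 hs1) hs0 (by ring)
      have m2 := hconv hc4 hc1 (sub_nonneg.2 hs1) hs0 (by ring)
      have m3 := hconv m1 m2 (sub_nonneg.2 ht1) ht0 (by ring)
      convert m3 using 1
      module

theorem isParallelogram_iff (h : IsGaugeModel C L) (hconv : Convex ℝ C)
    {ω : F →ₗ[ℝ] F →ₗ[ℝ] ℝ} (hω : IsAreaForm ω) : IsParallelogram C ↔ HasSquareBall F :=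
  ⟨h.hasSquareBall_of_isParallelogram, h.isParallelogram_of_hasSquareBall hconv hω⟩

end IsGaugeModel

end Model

/-! ### The determinant as area form, and its transport to the model. -/

section Plane

/-- The determinant as a bilinear form on the Euclidean plane. -/
noncomputable def planeDet :
    EuclideanSpace ℝ (Fin 2) →ₗ[ℝ] EuclideanSpace ℝ (Fin 2) →ₗ[ℝ] ℝ :=
  LinearMap.mk₂ ℝ (fun x y => x 0 * y 1 - x 1 * y 0)
    (fun x y z => by simp; ring) (fun c x y => by simp; ring)
    (fun x y z => by simp; ring) (fun c x y => by simp; ring)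

theorem planeDet_apply (x y : EuclideanSpace ℝ (Fin 2)) :
    planeDet x y = x 0 * y 1 - x 1 * y 0 := rfl

theorem isAreaForm_planeDet : IsAreaForm planeDet where
  self x := by rw [planeDet_apply]; ring
  cramer a b c := by
    ext i
    fin_cases i <;> simp [planeDet_apply] <;> ring
  nondegenerate x hx := by
    refine ⟨!₂[-x 1, x 0], fun h0 => hx ?_⟩
    simp only [planeDet_apply, Matrix.cons_val_zero, Matrix.cons_val_one] at h0
    have h1 : x 0 = 0 := by nlinarith [mul_self_nonneg (x 0), mul_self_nonneg (x 1)]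
    have h2 : x 1 = 0 := by nlinarith [mul_self_nonneg (x 0), mul_self_nonneg (x 1)]
    ext i
    fin_cases i <;> simp [h1, h2]

theorem IsAreaForm.map {E F : Type*} [NormedAddCommGroup E] [NormedSpace ℝ E]
    [NormedAddCommGroup F] [NormedSpace ℝ F] {ω : E →ₗ[ℝ] E →ₗ[ℝ] ℝ} (h : IsAreaForm ω)
    (L : E ≃ₗ[ℝ] F) :
    IsAreaForm (ω.compl₁₂ L.symm.toLinearMap L.symm.toLinearMap) where
  self x := h.self _
  cramer a b c := L.symm.injective (by
    simpa using h.cramer (L.symm a) (L.symm b) (L.symm c))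
  nondegenerate x hx := by
    obtain ⟨y, hy⟩ := h.nondegenerate (L.symm x) (by simpa using hx)
    exact ⟨L y, by simpa using hy⟩

end Plane

theorem mainTheorem8 (C : Set (EuclideanSpace ℝ (Fin 2)))
    (hconv : Convex ℝ C) (hcomp : IsCompact C) (hint : (interior C).Nonempty) :
    (¬ IsParallelogram C →
      hadwigerNumber C = 6 ∧ strictHadwigerNumber C = 5 ∧ oneSidedHadwigerNumber C = 4) ∧
    (IsParallelogram C →
      hadwigerNumber C = 8 ∧ strictHadwigerNumber C = 4 ∧ oneSidedHadwigerNumber C = 5) ∧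
    (1 < maxBoundarySegment (centralSymmetral C) → openOneSidedHadwigerNumber C = 4) ∧
    (¬ 1 < maxBoundarySegment (centralSymmetral C) → openOneSidedHadwigerNumber C = 3) := by
  obtain ⟨F, _, _, L, hL⟩ := exists_isGaugeModel hconv hcomp hint
  have hω := isAreaForm_planeDet.map L
  set ω := planeDet.compl₁₂ L.symm.toLinearMap L.symm.toLinearMap
  have hF : 1 < Module.rank ℝ F := by
    rw [← L.rank_eq, ← Module.finrank_eq_rank, finrank_euclideanSpace_fin]
    norm_num
  rw [hL.isParallelogram_iff hconv hω, hL.one_lt_maxBoundarySegment_iff hconv hint]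
  have hH : ∀ n : ℕ, (∀ s : Finset F, IsSeparated (s : Set F) → s.card ≠ n + 1) →
      (∃ W : Set F, IsSeparated W ∧ W.encard = n) → hadwigerNumber C = n := fun n hub hex =>
    sSup_encard_eq L.toEquiv hL.isHadwigerFamily_iff hub (fun _ _ hW h => h.mono hW) hex
  have hS : ∀ n : ℕ, (∀ s : Finset F, IsStrictlySeparated (s : Set F) → s.card ≠ n + 1) →
      (∃ W : Set F, IsStrictlySeparated W ∧ W.encard = n) → strictHadwigerNumber C = n :=
    fun n hub hex => sSup_encard_eq L.toEquiv hL.isStrictHadwigerFamily_iff hub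
      (fun _ _ hW h => h.mono hW) hex
  have hC : ∀ n : ℕ, (∀ (f : F →ₗ[ℝ] ℝ), f ≠ 0 → ∀ s : Finset F, IsSeparated (s : Set F) →
        (∀ v ∈ s, 0 ≤ f v) → s.card ≠ n + 1) →
      (∃ W : Set F, IsSeparated W ∧ W.encard = n ∧
        ∃ f : F →ₗ[ℝ] ℝ, f ≠ 0 ∧ ∀ v ∈ W, 0 ≤ f v) → oneSidedHadwigerNumber C = n :=
    fun n hub ⟨W, hW, hWn, hf⟩ => sSup_encard_eq L.toEquiv
      (Q := fun W => IsSeparated W ∧ ∃ f : F →ₗ[ℝ] ℝ, f ≠ 0 ∧ ∀ v ∈ W, 0 ≤ f v)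
      (fun V => and_congr (hL.isHadwigerFamily_iff V) (inClosedHalfSpace_iff L V))
      (fun s ⟨hs, f, hf, hsf⟩ => hub f hf s hs hsf)
      (fun _ _ hW ⟨h, f, hf, hsf⟩ => ⟨h.mono hW, f, hf, fun v hv => hsf v (hW hv)⟩)
      ⟨W, ⟨hW, hf⟩, hWn⟩
  have hO : ∀ n : ℕ, (∀ (f : F →ₗ[ℝ] ℝ), f ≠ 0 → ∀ s : Finset F, IsSeparated (s : Set F) →
        (∀ v ∈ s, 0 < f v) → s.card ≠ n + 1) →
      (∃ W : Set F, IsSeparated W ∧ W.encard = n ∧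
        ∃ f : F →ₗ[ℝ] ℝ, f ≠ 0 ∧ ∀ v ∈ W, 0 < f v) → openOneSidedHadwigerNumber C = n :=
    fun n hub ⟨W, hW, hWn, hf⟩ => sSup_encard_eq L.toEquiv
      (Q := fun W => IsSeparated W ∧ ∃ f : F →ₗ[ℝ] ℝ, f ≠ 0 ∧ ∀ v ∈ W, 0 < f v)
      (fun V => and_congr (hL.isHadwigerFamily_iff V) (inOpenHalfSpace_iff L V))
      (fun s ⟨hs, f, hf, hsf⟩ => hub f hf s hs hsf)
      (fun _ _ hW ⟨h, f, hf, hsf⟩ => ⟨h.mono hW, f, hf, fun v hv => hsf v (hW hv)⟩)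
      ⟨W, ⟨hW, hf⟩, hWn⟩
  refine ⟨fun hsq => ⟨?_, ?_, ?_⟩, fun hsq => ⟨?_, ?_, ?_⟩, fun hlong => ?_, fun hlong => ?_⟩
  · exact hH 6 (fun s hs => hω.card_ne_seven hsq s hs) (exists_six hF)
  · refine hS 5 (fun s hs => hω.card_ne_six_of_strict s hs) ?_
    by_cases hlong : HasLongSide F
    · exact exists_five_strict_of_hasLongSide hlong hsq
    · exact exists_five_strict_of_not_hasLongSide hF hlong hsq
  · exact hC 4 (fun f hf s hs hsf hn => hsq (hω.hasSquareBall_of_card_eq_five hf s hs hsf hn))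
      (hω.exists_four_closed hF)
  · exact hH 8 (fun s hs => hω.card_ne_nine s hs) (hω.exists_eight hsq)
  · exact hS 4 (fun s hs => hω.card_ne_five_of_strict_of_square hsq s hs)
      (hω.exists_four_strict hsq)
  · exact hC 5 (fun f hf s hs hsf => hω.card_ne_six_of_halfPlane hf s hs hsf)
      (hω.exists_five_closed hsq)
  -- An open half plane contains no antipodal pair, so five vectors are excluded whether or not
  -- there is a long side.
  · refine hO 4 (fun f hf s hs hsf => hω.card_ne_five_of_neg_notMem hf s hs
      (fun v hv => (hsf v hv).le) fun v hv hv' => ?_) (hω.exists_four_open hlong)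
    have := hsf _ hv'
    rw [map_neg] at this
    linarith [hsf v hv]
  · exact hO 3 (fun f hf s hs hsf hn =>
      hlong (hω.hasLongSide_of_card_eq_four hf s hs hsf hn)) (hω.exists_three_open hF)
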